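/- Let $\Sigma$ be a finite nonempty alphabet, fix a padding symbol $\Box\in\Sigma$, and let $L\subseteq\Sigma^*$ be a regular language. For $n\in\mathbb{N}$ and $x\in\Sigma^*$ let $\mathrm{last}_n(x)\in\Sigma^n$ be the suffix of length $n$ of $x$, where $x$ is padded on the left with $\Box$ if $|x|<n$, and let $\mathrm{SW}_n(L)=\{x\in\Sigma^*\mid \mathrm{last}_n(x)\in L\}$. A randomized streaming algorithm is a probabilistic automaton $\mathcal P=(Q,\Sigma,\iota,\rho,F)$ with a nonempty state set $Q$, an initial distribution $\iota$ on $Q$, transition probabilities $\rho(p,a,\cdot)$ (a distribution on $Q$ for all $p\in Q$, $a\in\Sigma$), and final states $F\subseteq Q$; it accepts $x$ with the probability that its random state after reading $x$ lies in $F$, and rejects $x$ with the complementary probability. Let $\mathsf F^{\mathsf r}_L(n)$ be the minimum of $\log_2|Q|$ over all such automata that accept every $x\in \mathrm{SW}_n(L)$ with probability at least $2/3$ and reject every $x\in\Sigma^*\setminus \mathrm{SW}_n(L)$ with probability at least $2/3$. Let $\mathbf{Len}$ be the class of regular languages $K\subseteq\Sigma^*$ such that for every $n\ge 0$ either $\Sigma^n\subseteq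 K$ or $\Sigma^n\cap K=\emptyset$; let $\mathbf{ST}$ be the class of finite Boolean combinations of languages $\Sigma^*w$ with $w\in\Sigma^*$; let $\mathbf{SF}$ be the class of regular languages $K\subseteq\Sigma^*$ such that $xy\in K$ and $x\ne\varepsilon$ imply $y\notin K$; and let $\mathbf{LI}$ be the class of languages $\Sigma^*K$ with $K\subseteq\Sigma^*$ regular. Let $\langle\mathbf L_1,\dots,\mathbf L_k\rangle$ be the class of finite Boolean combinations of languages in $\mathbf L_1\cup\dots\cup\mathbf L_k$. For $f,g\colon\mathbb N\to\mathbb R$ write $f=\bar\Omega(g)$ if there is $c>0$ with $f(n)\ge c\,g(n)$ for infinitely many $n$, and $f=\bar\Theta(g)$ if $f=O(g)$ and $f=\bar\Omega(g)$. All logarithms have base two. Then $\mathsf F^{\mathsf r}_L(n)$ is $\Theta(1)$, $\bar\Theta(\log\log n)$, $\bar\Theta(\log n)$ or $\bar\Theta(n)$, where $\Theta(1)$ means that $\mathsf F^{\mathsf r}_L$ is bounded and that there is $c>0$ with $\mathsf F^{\mathsf r}_L(n)\ge c$ for every $n$ with $\emptyset\ne L\cap\Sigma^n\neq\Sigma^n$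 (for all other $n$ one has $\mathsf F^{\mathsf r}_L(n)=0$). Furthermore, \begin{align*} \mathsf F^{\mathsf r}_L(n)=O(1)&\iff L\in\langle\mathbf{ST},\mathbf{Len}\rangle,\\ \mathsf F^{\mathsf r}_L(n)=O(\log\log n)&\iff L\in\langle\mathbf{ST},\mathbf{SF},\mathbf{Len}\rangle,\\ \mathsf F^{\mathsf r}_L(n)=O(\log n)&\iff L\in\langle\mathbf{LI},\mathbf{Len}\rangle, \end{align*} and \begin{align*} L\notin\langle\mathbf{ST},\mathbf{Len}\rangle&\implies \mathsf F^{\mathsf r}_L(n)=\bar\Omega(\log\log n),\\ L\notin\langle\mathbf{ST},\mathbf{SF},\mathbf{Len}\rangle&\implies \mathsf F^{\mathsf r}_L(n)=\bar\Omega(\log n),\\ L\notin\langle\mathbf{LI},\mathbf{Len}\rangle&\implies \mathsf F^{\mathsf r}_L(n)=\bar\Omega(n). \end{align*} -/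

import Mathlib

namespace SlidingWindow

open Filter Asymptotics

/-! ### Randomized streaming algorithms -/

/-- A probabilistic automaton (randomized streaming algorithm) over the alphabet `α` with state
set `σ`. A `PMF` is a function with values in `[0,1]` that sums to one, so `σ` is nonempty. -/
structure ProbAutomaton (α : Type*) (σ : Type*) where
  /-- initial state distribution -/
  init : PMF σ
  /-- transition probabilities -/
  step : σ → α → PMF σ
  /-- final states -/
  accept : Set σ

namespace ProbAutomaton

variable {α σ : Type*}

/-- The distribution of the state reached after reading `w`:
`Pr[P(wa) = q] = ∑ p, Pr[P(w) = p] * ρ(p, a, q)`. -/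
noncomputable def dist (P : ProbAutomaton α σ) (w : List α) : PMF σ :=
  w.foldl (fun μ a => μ.bind fun p => P.step p a) P.init

/-- The probability that `w` is accepted. -/
noncomputable def acceptProb (P : ProbAutomaton α σ) (w : List α) : ℝ :=
  ((P.dist w).toOuterMeasure P.accept).toReal

/-- The probability that `w` is rejected. -/
noncomputable def rejectProb (P : ProbAutomaton α σ) (w : List α) : ℝ :=
  ((P.dist w).toOuterMeasure P.acceptᶜ).toReal

/-- `P` is a randomized streaming algorithm for `L` with two-sided error probability `err`. -/
def IsFor (P : ProbAutomaton α σ) (L : Language α) (err : ℝ) : Prop :=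
  (∀ w ∈ L, 1 - err ≤ P.acceptProb w) ∧ (∀ w ∉ L, 1 - err ≤ P.rejectProb w)

end ProbAutomaton

/-! ### The fixed-size sliding window model -/

/-- The window of length `n`: the last `n` symbols of the stream `x`, padded on the left by the
symbol `pad` if `x` is shorter than `n`. -/
def lastN {α : Type*} (pad : α) (n : ℕ) (x : List α) : List α :=
  (List.replicate (n - x.length) pad ++ x).rtake n

/-- The sliding window problem for `L` and window length `n`. -/
def SW {α : Type*} (pad : α) (n : ℕ) (L : Language α) : Language α :=
  {x | lastN pad n x ∈ L}

theorem lastN_length {α : Type*} (pad : α) (n : ℕ) (x : List α) :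
    (lastN pad n x).length = n := by
  simp [lastN, List.rtake]
  omega

theorem lastN_snoc {α : Type*} (pad : α) (n : ℕ) (x : List α) (a : α) :
    lastN pad n (x ++ [a]) = lastN pad n (lastN pad n x ++ [a]) := by
  rcases Nat.eq_zero_or_pos n with rfl | hn
  · simp [lastN, List.rtake]
  · have h1 : n - (lastN pad n x ++ [a]).length = 0 := by simp [lastN_length]
    rw [lastN.eq_1 pad n (lastN pad n x ++ [a]), h1]
    simp only [lastN, List.rtake, List.replicate_zero, List.nil_append, List.length_append,
      List.length_replicate, List.length_drop, List.length_singleton]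
    by_cases h : n ≤ x.length
    · have h2 : n - x.length = 0 := by omega
      have h3 : n - (x.length + 1) = 0 := by omega
      simp only [h2, h3, List.replicate_zero, List.nil_append, Nat.zero_add]
      rw [List.drop_append_of_le_length (by omega), List.drop_append_of_le_length
        (by simp; omega), List.drop_drop]
      congr 2
      omega
    · have h2 : n - x.length + x.length - n = 0 := by omega
      have h3 : n - (x.length + 1) + (x.length + 1) - n = 0 := by omega
      have h4 : n - x.length = n - (x.length + 1) + 1 := by omega
      rw [h2, h3, h4]
      simp only [List.drop_zero, List.replicate_succ, List.cons_append, List.append_assoc]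
      have h5 : n - (x.length + 1) + 1 + x.length -
          0 + 1 - n = 1 := by omega
      rw [h5]
      simp

/-- The trivial algorithm, which stores the window, has finitely many states. -/
theorem spaceSet_nonempty {α : Type*} [Finite α] (pad : α) (L : Language α) (n : ℕ) :
    {s : ℝ | ∃ (σ : Type) (_ : Finite σ) (P : ProbAutomaton α σ),
      P.IsFor (SW pad n L) (1 / 3) ∧ s = Real.logb 2 (Nat.card σ)}.Nonempty := by
  classical
  have : Finite {l : List α // l.length = n} := (List.finite_length_eq α n).to_subtype
  obtain ⟨k, ⟨e⟩⟩ := Finite.exists_equiv_fin {l : List α // l.length = n}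
  let f : List α → Fin k := fun x => e ⟨lastN pad n x, lastN_length pad n x⟩
  let P : ProbAutomaton α (Fin k) :=
    { init := PMF.pure (f [])
      step := fun q a => PMF.pure (f ((e.symm q).1 ++ [a]))
      accept := {q | (e.symm q).1 ∈ L} }
  have hd : ∀ w, P.dist w = PMF.pure (f w) := by
    intro w
    induction w using List.reverseRecOn with
    | nil => rfl
    | append_singleton w a ih =>
      have : P.dist (w ++ [a]) = (P.dist w).bind fun p => P.step p a := by
        simp [ProbAutomaton.dist]
      rw [this, ih, PMF.pure_bind]
      simp only [P, f, Equiv.symm_apply_apply]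
      simp only [← lastN_snoc]
  refine ⟨_, Fin k, inferInstance, P, ⟨fun w hw => ?_, fun w hw => ?_⟩, rfl⟩
  · have hw' : f w ∈ P.accept := by
      simp only [P, f, Set.mem_ofPred_eq, Equiv.symm_apply_apply]
      exact hw
    rw [ProbAutomaton.acceptProb, hd, PMF.toOuterMeasure_pure_apply, if_pos hw']
    norm_num
  · have hw' : f w ∈ P.acceptᶜ := by
      simp only [P, f, Set.mem_compl_iff, Set.mem_ofPred_eq, Equiv.symm_apply_apply]
      exact hw
    rw [ProbAutomaton.rejectProb, hd, PMF.toOuterMeasure_pure_apply, if_pos hw']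
    norm_num

/-- The randomized space complexity (two-sided error `1/3`) of `L` in the fixed-size sliding
window model: the least number of bits `log₂ |Q|` over all randomized streaming algorithms for
`SW pad n L`. Algorithms with infinitely many states use infinite space and do not contribute;
one with finitely many states always exists, see `spaceSet_nonempty`. -/
noncomputable def randSpace {α : Type*} (pad : α) (L : Language α) (n : ℕ) : ℝ :=
  sInf {s : ℝ | ∃ (σ : Type) (_ : Finite σ) (P : ProbAutomaton α σ),
    P.IsFor (SW pad n L) (1 / 3) ∧ s = Real.logb 2 (Nat.card σ)}

/-! ### Classes of languages -/

section Classes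

variable (α : Type*)

/-- Regular length languages: each `Σⁿ` is contained in `L` or disjoint from `L`. -/
def Len : Set (Language α) :=
  {L | L.IsRegular ∧
    ∀ n : ℕ, (∀ w : List α, w.length = n → w ∈ L) ∨ (∀ w : List α, w.length = n → w ∉ L)}

/-- Suffix-testable languages: finite Boolean combinations of the languages `Σ* w`. -/
def ST : Set (Language α) :=
  BooleanSubalgebra.closure {L : Language α | ∃ w : List α, L = ⊤ * {w}}

/-- Regular suffix-free languages. -/
def SF : Set (Language α) :=
  {L | L.IsRegular ∧ ∀ x y : List α, x ++ y ∈ L → x ≠ [] → y ∉ L}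

/-- Regular left ideals: the languages `Σ* K` with `K` regular. -/
def LI : Set (Language α) :=
  {L | ∃ K : Language α, K.IsRegular ∧ L = ⊤ * K}

end Classes

/-- All finite Boolean combinations of languages in `C`. -/
def BoolComb {α : Type*} (C : Set (Language α)) : Set (Language α) :=
  BooleanSubalgebra.closure C

/-! ### Asymptotic notation -/

/-- `f = Ω̄(g)`: `f n ≥ c * g n` for some `c > 0` and infinitely many `n`. -/
def OmegaBar (f g : ℕ → ℝ) : Prop :=
  ∃ c : ℝ, 0 < c ∧ ∃ᶠ n in atTop, c * g n ≤ f n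

/-- `f = Θ̄(g)`: `f = O(g)` and `f = Ω̄(g)`. -/
def ThetaBar (f g : ℕ → ℝ) : Prop :=
  f =O[atTop] g ∧ OmegaBar f g

/-- `SW pad n L` is a nontrivial problem: some but not all words of length `n` lie in `L`. -/
def NontrivialAt {α : Type*} (L : Language α) (n : ℕ) : Prop :=
  (∃ u : List α, u.length = n ∧ u ∈ L) ∧ (∃ v : List α, v.length = n ∧ v ∉ L)

/-- `f = Θ(1)` for a space complexity `f` of `L`: `f` is bounded, and it is bounded away from
zero on the window lengths at which the problem is nontrivial. (At every other window length a
single memory state suffices, so the space is `log 1 = 0`.) -/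
def ThetaOne {α : Type*} (L : Language α) (f : ℕ → ℝ) : Prop :=
  f =O[atTop] (fun _ => (1 : ℝ)) ∧ ∃ c : ℝ, 0 < c ∧ ∀ n, NontrivialAt L n → c ≤ f n

/-- `log₂ n`. -/
noncomputable def log2 (n : ℕ) : ℝ := Real.logb 2 n

/-- `log₂ log₂ n`. -/
noncomputable def loglog2 (n : ℕ) : ℝ := Real.logb 2 (Real.logb 2 n)

end SlidingWindow

namespace SlidingWindow

open Filter Asymptotics

variable {α : Type*}

/-! ### Regularity of some languages -/

/-! Let `M` be a finite automaton for the reversal of `L`. It reads the stream backwards, newest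
symbol first, and the window lies in `L` iff `M` accepts the prefix of length `n` of the reversed
stream. Everything is decided by the cycles of `M`. From a reachable state `p`, two words of equal
length may lead to states of different acceptance; call this a conflict at `p`.

If no recurrent state has a conflict, then `L` is in the first class (`mem_boolComb_ST_Len`). If no
recurrent state has a conflict between two recurrent targets, then `L` is in the second
(`mem_boolComb_ST_SF_Len`). If no state has a conflict within its strongly connected component, then
`L` is in the third (`mem_boolComb_LI_Len`).

Conversely, each kind of conflict embeds a communication problem. A conflict inside a component
yields two cycles of equal length that encode bits, hence augmented indexing and linear space
(`omegaBar_linear`). A conflict between recurrent targets encodes a number as a count of cycles,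
hence the comparison of numbers and logarithmic space (`omegaBar_log2`). Any conflict at a recurrent
state makes `N + 1` streams pairwise distinguishable for windows of length linear in `N`; as `m`
states distinguish at most `(6 * m + 1) ^ m` streams, `log m` is of order at least `log log N`
(`omegaBar_loglog2`).

The upper bounds come from one randomized automaton, `counter`, which tracks how far back the latest
match begins. It needs no numbers for `Σ* w`, numbers up to `n + 1` for left ideals, and residues
modulo a random prime of size polylogarithmic in `n` for suffix-free languages. Products of automata
take care of Boolean combinations. The equivalences follow since constants, `log log n`, `log n` and
`n` have strictly increasing growth. -/

theorem isRegular_accepts {σ : Type*} [Finite σ] (M : DFA α σ) : M.accepts.IsRegular := by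
  have := Fintype.ofFinite σ
  exact Language.isRegular_iff.2 ⟨σ, inferInstance, M, rfl⟩

/-- The language of all words at which a finite automaton is in a state from `G`. -/
theorem isRegular_eval_mem {σ : Type*} [Finite σ] (M : DFA α σ) (G : Set σ) :
    Language.IsRegular ({w | M.eval w ∈ G} : Set (List α)) :=
  isRegular_accepts (⟨M.step, M.start, G⟩ : DFA α σ)

/-- The left quotient by `x` depends only on the first `k` symbols of `x`, so there are finitely
many quotients. -/
theorem isRegular_of_take [Finite α] (k : ℕ) (K : Language α)
    (h : ∀ w, w ∈ K ↔ w.take k ∈ K) : K.IsRegular := by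
  apply Language.IsRegular.of_finite_range_leftQuotient
  refine ((List.finite_length_le α k).image K.leftQuotient).subset ?_
  rintro _ ⟨x, rfl⟩
  refine ⟨x.take k, by simp, ?_⟩
  ext y
  rw [Language.mem_leftQuotient, Language.mem_leftQuotient, h, h (x ++ y)]
  congr! 1
  rw [List.take_append, List.take_append, List.take_take, min_self, List.length_take]
  congr 2
  omega

theorem isRegular_length_mod (P s : ℕ) (hP : 0 < P) :
    Language.IsRegular ({w | w.length % P = s} : Set (List α)) := by
  apply Language.IsRegular.of_finite_range_leftQuotient
  refine ((Set.finite_Iio P).image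
    fun r => ({w | (r + w.length) % P = s} : Set (List α))).subset ?_
  rintro _ ⟨x, rfl⟩
  refine ⟨x.length % P, Nat.mod_lt _ hP, ?_⟩
  ext y
  change _ ↔ (x ++ y).length % P = s
  simp

/-- The words having the same length as some word of a regular language. -/
theorem isRegular_length {K : Language α} (hK : K.IsRegular) :
    Language.IsRegular ({w | ∃ u ∈ K, u.length = w.length} : Set (List α)) := by
  obtain ⟨σ, _, M, rfl⟩ := hK
  -- A subset automaton that ignores the letter it reads: its state is the set of states of `M`
  -- reachable by words of the current length.
  let N : DFA α (Set σ) :=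
    ⟨fun S _ => {q | ∃ p ∈ S, ∃ b, M.step p b = q}, {M.start}, {S | ∃ q ∈ S, q ∈ M.accept}⟩
  have hN : ∀ w, N.eval w = {q | ∃ u : List α, u.length = w.length ∧ M.eval u = q} := by
    intro w
    induction w using List.reverseRecOn with
    | nil => ext q; simp [N, eq_comm]
    | append_singleton w a ih =>
      rw [DFA.eval_append_singleton, ih]
      ext q
      constructor
      · rintro ⟨p, ⟨u, hu, rfl⟩, b, rfl⟩
        exact ⟨u ++ [b], by simp [hu], by simp⟩
      · rintro ⟨u, hu, rfl⟩
        rcases List.eq_nil_or_concat' u with rfl | ⟨u, b, rfl⟩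
        · simp at hu
        · exact ⟨M.eval u, ⟨u, by simpa using hu, rfl⟩, b, by simp⟩
  have hNM : N.accepts = ({w | ∃ u ∈ M.accepts, u.length = w.length} : Set (List α)) := by
    ext w
    change N.eval w ∈ N.accept ↔ _
    rw [hN]
    constructor
    · rintro ⟨_, ⟨u, h, rfl⟩, hu⟩
      exact ⟨u, hu, h⟩
    · rintro ⟨u, hu, h⟩
      exact ⟨_, ⟨u, h, rfl⟩, hu⟩
  rw [← hNM]
  exact isRegular_accepts N

/-! ### Boolean combinations -/

theorem subset_boolComb {C : Set (Language α)} {K : Language α} (h : K ∈ C) : K ∈ BoolComb C :=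
  BooleanSubalgebra.subset_closure h

/-- A language is a Boolean combination of finitely many languages if membership in these
determines membership in it. -/
theorem mem_boolComb_of_signature {C : Set (Language α)} {ι : Type*} [Finite ι]
    {K : ι → Language α} (hK : ∀ i, K i ∈ BoolComb C) {L : Language α}
    (h : ∀ w w', (∀ i, w ∈ K i ↔ w' ∈ K i) → w ∈ L → w' ∈ L) : L ∈ BoolComb C := by
  classical
  have := Fintype.ofFinite ι
  let A := BooleanSubalgebra.closure C
  let sig : List α → Set ι := fun w => {i | w ∈ K i}
  -- The cells are the atoms of the Boolean algebra generated by the `K i`; `L` is the union of the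
  -- cells that it meets.
  let cell : Set ι → Language α := fun S =>
    Finset.univ.inf fun i => if i ∈ S then K i else (K i)ᶜ
  have hcell : ∀ S, cell S ∈ A := fun S => by
    refine Finset.inf_induction (p := (· ∈ A)) BooleanSubalgebra.top_mem
      (fun _ ha _ hb => BooleanSubalgebra.inf_mem ha hb) fun i _ => ?_
    split_ifs
    · exact hK i
    · exact BooleanSubalgebra.compl_mem (hK i)
  have hmem : ∀ S w, w ∈ cell S ↔ sig w = S := by
    intro S w
    have : ∀ T : Finset ι, (w ∈ T.inf fun i => if i ∈ S then K i else (K i)ᶜ) ↔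
        ∀ i ∈ T, (w ∈ K i ↔ i ∈ S) := by
      intro T
      induction T using Finset.induction_on with
      | empty => simp only [Finset.inf_empty, Finset.notMem_empty, false_imp_iff, implies_true,
          iff_true]; exact trivial
      | insert j T hj ih =>
        rw [Finset.inf_insert, Finset.forall_mem_insert, ← ih]
        refine and_congr_left fun _ => ?_
        split_ifs with hS
        · exact (iff_true_right hS).symm
        · exact (iff_false_right hS).symm
    rw [this]
    simp [sig, Set.ext_iff]
  let T : Finset (Set ι) := Finset.univ.filter fun S => ∃ w ∈ L, sig w = S
  have hL : L = T.sup cell := by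
    ext w
    have : ∀ T : Finset (Set ι), w ∈ T.sup cell ↔ sig w ∈ T := by
      intro T
      induction T using Finset.induction_on with
      | empty => simp only [Finset.sup_empty, Finset.notMem_empty, iff_false]; exact id
      | insert j T hj ih =>
        rw [Finset.sup_insert, Finset.mem_insert, ← ih, ← hmem]; exact Iff.rfl
    rw [this]
    simp only [T, Finset.mem_filter, Finset.mem_univ, true_and]
    refine ⟨fun hw => ⟨w, hw, rfl⟩, fun ⟨u, hu, hs⟩ => h u w (fun i => ?_) hu⟩
    exact Set.ext_iff.1 hs i
  rw [hL]
  exact Finset.sup_induction (p := (· ∈ A)) BooleanSubalgebra.bot_mem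
      (fun _ ha _ hb => BooleanSubalgebra.sup_mem ha hb) fun i _ => hcell i

/-! ### The four classes in terms of reversed words -/

theorem length_mem_Len {K : Language α} (hK : K.IsRegular) :
    ({w | ∃ u ∈ K, u.length = w.length} : Set (List α)) ∈ Len α := by
  refine ⟨isRegular_length hK, fun n => ?_⟩
  by_cases h : ∃ u ∈ K, u.length = n
  · obtain ⟨u, hu, rfl⟩ := h
    exact Or.inl fun w hw => ⟨u, hu, hw.symm⟩
  · refine Or.inr fun w hw ⟨u, hu, hl⟩ => h ⟨u, hu, hl.trans hw⟩

theorem length_mod_mem_Len (P s : ℕ) (hP : 0 < P) :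
    ({w | w.length % P = s} : Set (List α)) ∈ Len α := by
  refine ⟨isRegular_length_mod P s hP, fun n => ?_⟩
  by_cases h : n % P = s
  · exact Or.inl fun w hw => by subst hw; exact h
  · exact Or.inr fun w hw => by subst hw; exact h

theorem prefix_reverse_mem_ST (v : List α) :
    ({w | v <+: w.reverse} : Set (List α)) ∈ ST α := by
  refine BooleanSubalgebra.subset_closure ⟨v.reverse, ?_⟩
  ext w
  rw [Language.mem_mul]
  constructor
  · rintro ⟨t, ht⟩
    refine ⟨t.reverse, trivial, v.reverse, rfl, ?_⟩
    rw [← List.reverse_append, ht, List.reverse_reverse]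
  · rintro ⟨a, -, b, hb, rfl⟩
    obtain rfl : b = v.reverse := hb
    exact ⟨a.reverse, by simp⟩

theorem exists_prefix_reverse_mem_LI {K : Language α} (hK : K.IsRegular) :
    ({w | ∃ v ∈ K, v <+: w.reverse} : Set (List α)) ∈ LI α := by
  refine ⟨K.reverse, hK.reverse, ?_⟩
  ext w
  rw [Language.mem_mul]
  constructor
  · rintro ⟨v, hv, t, ht⟩
    refine ⟨t.reverse, trivial, v.reverse, by simpa [Language.mem_reverse] using hv, ?_⟩
    rw [← List.reverse_append, ht, List.reverse_reverse]
  · rintro ⟨a, -, b, hb, rfl⟩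
    exact ⟨b.reverse, hb, a.reverse, by simp⟩

theorem reverse_mem_SF {K : Language α} (hK : K.IsRegular)
    (h : ∀ x y, x ∈ K → y ≠ [] → x ++ y ∉ K) : K.reverse ∈ SF α := by
  refine ⟨hK.reverse, fun x y hxy hx hy => ?_⟩
  refine h y.reverse x.reverse hy (by simpa using hx) ?_
  rw [← List.reverse_append]
  exact hxy

/-! ### Automata for the reversed language and membership in the classes -/

section Structure

variable {σ : Type} (M : DFA α σ)

/-- `p` lies on a nonempty cycle. -/
def Recurrent (p : σ) : Prop := ∃ v, v ≠ [] ∧ M.evalFrom p v = p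

theorem eval_append (u v : List α) : M.eval (u ++ v) = M.evalFrom (M.eval u) v :=
  M.evalFrom_of_append _ u v

theorem evalFrom_flatten_replicate {p : σ} {v : List α} (h : M.evalFrom p v = p) (j : ℕ) :
    M.evalFrom p (List.replicate j v).flatten = p := by
  induction j with
  | zero => rfl
  | succ j ih => rw [List.replicate_succ, List.flatten_cons, DFA.evalFrom_of_append, h, ih]

variable [Fintype σ]

/-- Pigeonhole: a run of at least `Fintype.card σ` steps repeats a state, and the first visit to
that state comes early. -/
theorem exists_recurrent_prefix {w : List α} (hw : Fintype.card σ ≤ w.length) :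
    ∃ v c, w = v ++ c ∧ v.length ≤ Fintype.card σ ∧ Recurrent M (M.eval v) := by
  obtain ⟨q, a, b, c, rfl, hl, hb, ha, hq, -⟩ := M.evalFrom_split (s := M.start) hw rfl
  refine ⟨a, b ++ c, by simp, by omega, b, hb, ?_⟩
  rw [show M.eval a = q from ha, hq]

/-- The first `k` symbols of the reversed word already pass through a recurrent state, unless the
word is shorter than `k`. After that state only the length matters. So it suffices to know these
symbols and whether some accepted word with the same beginning has the same length. -/
theorem mem_boolComb_ST_Len [Finite α] {L : Language α} (hM : M.accepts = L.reverse)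
    (h : ∀ v t t', Recurrent M (M.eval v) → t.length = t'.length →
      M.evalFrom (M.eval v) t ∈ M.accept → M.evalFrom (M.eval v) t' ∈ M.accept) :
    L ∈ BoolComb (ST α ∪ Len α) := by
  have hL : ∀ w, w ∈ L ↔ M.eval w.reverse ∈ M.accept := fun w => by
    rw [← Language.reverse_mem_reverse, ← hM]; rfl
  set k := Fintype.card σ
  have : Finite {v : List α // v.length ≤ k} := (List.finite_length_le α k).to_subtype
  let A : {v : List α // v.length ≤ k} → Language α := fun v =>
    M.accepts ⊓ ({w | w.take k = v} : Set (List α))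
  have hA : ∀ v, (A v).IsRegular := fun v =>
    Language.IsRegular.inf (isRegular_accepts M) (isRegular_of_take k _ fun w => by
      change w.take k = v.1 ↔ (w.take k).take k = v.1
      rw [List.take_take, min_self])
  refine mem_boolComb_of_signature
    (ι := {v : List α // v.length ≤ k} ⊕ {v : List α // v.length ≤ k})
    (K := Sum.elim (fun v => ({w | v.1 <+: w.reverse} : Set (List α)))
      (fun v => ({w | ∃ u ∈ A v, u.length = w.length} : Set (List α)))) ?_ ?_
  · rintro (v | v)
    · exact subset_boolComb (Or.inl (prefix_reverse_mem_ST v.1))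
    · exact subset_boolComb (Or.inr (length_mem_Len (hA v)))
  · intro w w' hw hwL
    let v : {v : List α // v.length ≤ k} := ⟨w.reverse.take k, by simp⟩
    have h1 : v.1 <+: w'.reverse := (hw (Sum.inl v)).1 (List.take_prefix _ _)
    obtain ⟨u, ⟨hu, huv⟩, hul⟩ := (hw (Sum.inr v)).1
      ⟨w.reverse, ⟨(hL w).1 hwL, rfl⟩, by simp⟩
    replace huv : u.take k = v.1 := huv
    replace hu : M.eval u ∈ M.accept := hu
    rw [hL]
    obtain ⟨t', ht'⟩ := h1
    have hut : u = v.1 ++ u.drop k := by rw [← huv, List.take_append_drop]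
    have hlen : (u.drop k).length = t'.length := by
      have h2 := congrArg List.length ht'
      have h3 := congrArg List.length hut
      simp only [List.length_append, List.length_reverse] at h2 h3
      omega
    rw [hut] at hu
    rw [← ht']
    by_cases hk : k ≤ v.1.length
    · obtain ⟨a, c, hac, -, hrec⟩ := exists_recurrent_prefix M hk
      rw [hac, List.append_assoc, eval_append] at hu ⊢
      exact h a _ _ hrec (by simp [hlen]) hu
    · have hd : u.drop k = [] := by
        have := congrArg List.length huv
        simp only [List.length_take] at this
        apply List.drop_eq_nil_of_le; omega
      rw [hd] at hu hlen
      obtain rfl : t' = [] := List.length_eq_zero_iff.1 hlen.symm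
      exact hu

/-- A run visits a non-recurrent state at most once, so the words ending in a fixed such state form
a prefix-free language, and their reversals a suffix-free one. These languages settle the words with
a non-recurrent end; for the others the argument with short prefixes and lengths applies among
recurrent ends. -/
theorem mem_boolComb_ST_SF_Len [Finite α] {L : Language α} (hM : M.accepts = L.reverse)
    (h : ∀ v t t', Recurrent M (M.eval v) → t.length = t'.length →
      Recurrent M (M.evalFrom (M.eval v) t) → Recurrent M (M.evalFrom (M.eval v) t') →
      M.evalFrom (M.eval v) t ∈ M.accept → M.evalFrom (M.eval v) t' ∈ M.accept) :
    L ∈ BoolComb (ST α ∪ SF α ∪ Len α) := by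
  have hL : ∀ w, w ∈ L ↔ M.eval w.reverse ∈ M.accept := fun w => by
    rw [← Language.reverse_mem_reverse, ← hM]; rfl
  set k := Fintype.card σ
  have : Finite {v : List α // v.length ≤ k} := (List.finite_length_le α k).to_subtype
  let A : {v : List α // v.length ≤ k} → Language α := fun v =>
    ({w | M.eval w ∈ {q | q ∈ M.accept ∧ Recurrent M q}} : Set (List α)) ⊓
      ({w | v.1 <+: w} : Set (List α))
  have hA : ∀ v, (A v).IsRegular := fun v =>
    Language.IsRegular.inf (isRegular_eval_mem M _) (isRegular_of_take v.1.length _ fun w => by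
      change _ <+: _ ↔ _ <+: _
      rw [List.prefix_take_iff]
      simp)
  let T : {q : σ // ¬ Recurrent M q} → Language α := fun q =>
    ({w | M.eval w ∈ ({q.1} : Set σ)} : Set (List α))
  refine mem_boolComb_of_signature
    (ι := ({v : List α // v.length ≤ k} ⊕ {v : List α // v.length ≤ k}) ⊕
      {q : σ // ¬ Recurrent M q})
    (K := Sum.elim (Sum.elim (fun v => ({w | v.1 <+: w.reverse} : Set (List α)))
      (fun v => ({w | ∃ u ∈ A v, u.length = w.length} : Set (List α))))
      (fun q => (T q).reverse)) ?_ ?_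
  · rintro ((v | v) | q)
    · exact subset_boolComb (Or.inl (Or.inl (prefix_reverse_mem_ST v.1)))
    · exact subset_boolComb (Or.inr (length_mem_Len (hA v)))
    · refine subset_boolComb (Or.inl (Or.inr (reverse_mem_SF (isRegular_eval_mem M _) ?_)))
      intro x y hx hy hxy
      replace hx : M.eval x = q.1 := hx
      replace hxy : M.eval (x ++ y) = q.1 := hxy
      rw [eval_append, hx] at hxy
      exact q.2 ⟨y, hy, hxy⟩
  · intro w w' hw hwL
    have hT : ∀ q (hq : ¬ Recurrent M q), M.eval w.reverse = q ↔ M.eval w'.reverse = q :=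
      fun q hq => hw (Sum.inr ⟨q, hq⟩)
    rw [hL] at hwL ⊢
    by_cases hr : Recurrent M (M.eval w.reverse)
    · have hr' : Recurrent M (M.eval w'.reverse) := by
        by_contra hr'
        rw [(hT _ hr').2 rfl] at hr
        exact hr' hr
      obtain ⟨v, c, hvc, hv, hrec⟩ : ∃ v c, w.reverse = v ++ c ∧ v.length ≤ k ∧
          Recurrent M (M.eval v) := by
        by_cases hk : k ≤ w.reverse.length
        · exact exists_recurrent_prefix M hk
        · exact ⟨w.reverse, [], by simp, by omega, hr⟩
      obtain ⟨t', ht'⟩ := (hw (Sum.inl (Sum.inl ⟨v, hv⟩))).1 ⟨c, hvc.symm⟩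
      obtain ⟨u, ⟨⟨hu, hur⟩, ⟨t, ht⟩⟩, hul⟩ := (hw (Sum.inl (Sum.inr ⟨v, hv⟩))).1
        ⟨w.reverse, ⟨⟨hwL, hr⟩, ⟨c, hvc.symm⟩⟩, by simp⟩
      simp only at ht ht'
      have hlen : t.length = t'.length := by
        have h2 := congrArg List.length ht'
        have h3 := congrArg List.length ht
        simp only [List.length_append, List.length_reverse] at h2 h3
        omega
      rw [← ht, eval_append] at hu hur
      rw [← ht', eval_append] at hr' ⊢
      exact h v t t' hrec hlen hur hr' hu
    · rwa [(hT _ hr).1 rfl]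

/-- A common length of cycles at all recurrent states. -/
theorem exists_common_period :
    ∃ P > 0, ∀ p, Recurrent M p → ∀ m, P ∣ m → ∃ v, v.length = m ∧ M.evalFrom p v = p := by
  classical
  choose! f hf hf' using fun p (hp : Recurrent M p) => hp
  -- The product of the lengths of one chosen cycle for every recurrent state.
  refine ⟨∏ p, if Recurrent M p then (f p).length else 1, Finset.prod_pos fun p _ => ?_, ?_⟩
  · split_ifs with hp
    · exact List.length_pos_iff.2 (hf p hp)
    · exact one_pos
  · intro p hp m hm
    have hd : (f p).length ∣ m := by
      refine dvd_trans ?_ hm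
      convert Finset.dvd_prod_of_mem _ (Finset.mem_univ p)
      rw [if_pos hp]
    obtain ⟨j, rfl⟩ := hd
    exact ⟨_, by simp [mul_comm], evalFrom_flatten_replicate M (hf' p hp) j⟩

/-- Let `p` be the final state for `w`. The family `I` says that the run of `w'` visits `p` at a
time congruent modulo `P` to the length of `w`. The family `J` says that this run never reaches a
state from which `p` is unreachable. Hence the run of `w'` ends in the component of `p`, and the
part after the visit has length divisible by `P`. A cycle at `p` of the same length exists, and the
hypothesis compares the two. -/
theorem mem_boolComb_LI_Len {L : Language α} (hM : M.accepts = L.reverse)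
    (h : ∀ y u v u' v', u.length = v.length →
      M.evalFrom (M.eval y) (u ++ u') = M.eval y → M.evalFrom (M.eval y) (v ++ v') = M.eval y →
      M.evalFrom (M.eval y) u ∈ M.accept → M.evalFrom (M.eval y) v ∈ M.accept) :
    L ∈ BoolComb (LI α ∪ Len α) := by
  have hL : ∀ w, w ∈ L ↔ M.eval w.reverse ∈ M.accept := fun w => by
    rw [← Language.reverse_mem_reverse, ← hM]; rfl
  obtain ⟨P, hP, hper⟩ := exists_common_period M
  let N : σ → Set σ := fun p => {q | ∀ v, M.evalFrom q v ≠ p}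
  let I : σ → Fin P → Language α := fun p s =>
    ({w | M.eval w ∈ ({p} : Set σ)} : Set (List α)) ⊓ ({w | w.length % P = s} : Set (List α))
  let J : σ → Language α := fun p => ({w | M.eval w ∈ N p} : Set (List α))
  refine mem_boolComb_of_signature (ι := (σ × Fin P) ⊕ σ ⊕ Fin P)
    (K := Sum.elim (fun x => ({w | ∃ v ∈ I x.1 x.2, v <+: w.reverse} : Set (List α)))
      (Sum.elim (fun p => ({w | ∃ v ∈ J p, v <+: w.reverse} : Set (List α)))
        (fun s => ({w | w.length % P = s} : Set (List α))))) ?_ ?_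
  · rintro (⟨p, s⟩ | p | s)
    · exact subset_boolComb (Or.inl (exists_prefix_reverse_mem_LI
        ((isRegular_eval_mem M _).inf (isRegular_length_mod P s hP))))
    · exact subset_boolComb (Or.inl (exists_prefix_reverse_mem_LI (isRegular_eval_mem M _)))
    · exact subset_boolComb (Or.inr (length_mod_mem_Len P s hP))
  · intro w w' hw hwL
    rw [hL] at hwL ⊢
    let s : Fin P := ⟨w.length % P, Nat.mod_lt _ hP⟩
    have hs : w'.length % P = w.length % P := (hw (Sum.inr (Sum.inr s))).1 rfl
    obtain ⟨v, ⟨hv, hvs⟩, t, ht⟩ := (hw (Sum.inl (M.eval w.reverse, s))).1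
      ⟨w.reverse, ⟨rfl, by change w.reverse.length % P = w.length % P; simp⟩, List.prefix_rfl⟩
    replace hv : M.eval v = M.eval w.reverse := hv
    replace hvs : v.length % P = w.length % P := hvs
    have hJ : ¬ ∃ u ∈ J (M.eval w.reverse), u <+: w'.reverse := by
      rw [show (∃ u ∈ J (M.eval w.reverse), u <+: w'.reverse) ↔ _ from
        (hw (Sum.inr (Sum.inl (M.eval w.reverse)))).symm]
      rintro ⟨u, hu, c, hc⟩
      refine hu c ?_
      rw [← eval_append, hc]
    obtain ⟨e, he⟩ : ∃ e, M.evalFrom (M.eval w'.reverse) e = M.eval w.reverse := by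
      by_contra! hne
      exact hJ ⟨w'.reverse, hne, List.prefix_rfl⟩
    rw [← hv] at hwL he
    rw [← ht, eval_append] at he ⊢
    rcases eq_or_ne t [] with rfl | htn
    · exact hwL
    have hrec : Recurrent M (M.eval v) := ⟨t ++ e, by simp [htn], by
      rw [DFA.evalFrom_of_append, he]⟩
    have htP : P ∣ t.length := by
      have h2 := congrArg List.length ht
      simp only [List.length_append, List.length_reverse] at h2
      have h3 : (v.length + t.length) ≡ v.length + 0 [MOD P] := by
        rw [h2, add_zero]; exact hs.trans hvs.symm
      exact (Nat.modEq_zero_iff_dvd).1 (Nat.ModEq.add_left_cancel' _ h3)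
    obtain ⟨u, hu, hup⟩ := hper _ hrec _ htP
    refine h v u t [] e hu (by simpa using hup) ?_ (by rwa [hup])
    rw [DFA.evalFrom_of_append, he]

end Structure

/-! ### Acceptance probabilities -/

namespace ProbAutomaton

variable {σ : Type*}

theorem dist_append (P : ProbAutomaton α σ) (x y : List α) :
    P.dist (x ++ y) =
      (P.dist x).bind fun q => ({ P with init := PMF.pure q } : ProbAutomaton α σ).dist y := by
  induction y using List.reverseRecOn with
  | nil => simp [dist]
  | append_singleton y a ih =>
    simp only [dist, List.foldl_append, List.foldl_cons, List.foldl_nil] at ih ⊢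
    rw [ih, PMF.bind_bind]

theorem dist_snoc (P : ProbAutomaton α σ) (x : List α) (a : α) :
    P.dist (x ++ [a]) = (P.dist x).bind fun q => P.step q a := by
  simp [dist]

theorem acceptProb_nonneg (P : ProbAutomaton α σ) (w : List α) : 0 ≤ P.acceptProb w :=
  ENNReal.toReal_nonneg

theorem _root_.PMF.toOuterMeasure_add_compl (p : PMF σ) (s : Set σ) :
    p.toOuterMeasure s + p.toOuterMeasure sᶜ = 1 := by
  rw [PMF.toOuterMeasure_apply, PMF.toOuterMeasure_apply, ← ENNReal.tsum_add, ← p.tsum_coe]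
  exact tsum_congr fun a => congrFun (Set.indicator_self_add_compl s p) a

theorem _root_.PMF.toOuterMeasure_ne_top (p : PMF σ) (s : Set σ) : p.toOuterMeasure s ≠ ⊤ :=
  ne_top_of_le_ne_top ENNReal.one_ne_top
    (le_self_add.trans (p.toOuterMeasure_add_compl s).le)

theorem acceptProb_add_rejectProb (P : ProbAutomaton α σ) (w : List α) :
    P.acceptProb w + P.rejectProb w = 1 := by
  rw [acceptProb, rejectProb, ← ENNReal.toReal_add (PMF.toOuterMeasure_ne_top _ _)
    (PMF.toOuterMeasure_ne_top _ _), PMF.toOuterMeasure_add_compl, ENNReal.toReal_one]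

theorem acceptProb_le_one (P : ProbAutomaton α σ) (w : List α) : P.acceptProb w ≤ 1 := by
  have h : 0 ≤ P.rejectProb w := ENNReal.toReal_nonneg
  linarith [P.acceptProb_add_rejectProb w]

theorem isFor_iff (P : ProbAutomaton α σ) (K : Language α) (ε : ℝ) :
    P.IsFor K ε ↔ (∀ w ∈ K, 1 - ε ≤ P.acceptProb w) ∧ ∀ w ∉ K, P.acceptProb w ≤ ε := by
  refine and_congr_right fun _ => forall₂_congr fun w _ => ?_
  have := P.acceptProb_add_rejectProb w
  constructor <;> intro h <;> linarith

/-- The acceptance probability of `y` when started in the state `q`. -/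
noncomputable def acceptFrom (P : ProbAutomaton α σ) (y : List α) (q : σ) : ℝ :=
  ({ P with init := PMF.pure q } : ProbAutomaton α σ).acceptProb y

/-- Acceptance after a suffix is linear in the distribution on states. The lower bounds on the
number of states rest on this. -/
theorem acceptProb_append [Fintype σ] (P : ProbAutomaton α σ) (x y : List α) :
    P.acceptProb (x ++ y) = ∑ q, (P.dist x q).toReal * P.acceptFrom y q := by
  rw [acceptProb, dist_append, PMF.toOuterMeasure_bind_apply, tsum_fintype,
    ENNReal.toReal_sum fun q _ => ENNReal.mul_ne_top (PMF.apply_ne_top _ _)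
      (PMF.toOuterMeasure_ne_top _ _)]
  exact Finset.sum_congr rfl fun q _ => ENNReal.toReal_mul

theorem sum_dist [Fintype σ] (P : ProbAutomaton α σ) (x : List α) :
    ∑ q, (P.dist x q).toReal = 1 := by
  rw [← ENNReal.toReal_sum fun q _ => PMF.apply_ne_top _ _, ← tsum_fintype (L := .unconditional _),
    PMF.tsum_coe, ENNReal.toReal_one]

end ProbAutomaton

/-! ### A lower bound for augmented indexing -/

/-- The sum of a function over all bit strings of length `k`. -/
def bitSum : ℕ → (List Bool → ℝ) → ℝ
  | 0, f => f []
  | k + 1, f => bitSum k (fun r => f (true :: r)) + bitSum k (fun r => f (false :: r))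

theorem bitSum_mono {k : ℕ} {f g : List Bool → ℝ} (h : ∀ r, r.length = k → f r ≤ g r) :
    bitSum k f ≤ bitSum k g := by
  induction k generalizing f g with
  | zero => exact h [] rfl
  | succ k ih =>
    exact add_le_add (ih fun r hr => h _ (by simp [hr])) (ih fun r hr => h _ (by simp [hr]))

theorem bitSum_const (k : ℕ) (c : ℝ) : bitSum k (fun _ => c) = 2 ^ k * c := by
  induction k with
  | zero => simp [bitSum]
  | succ k ih => simp only [bitSum, ih]; ring

theorem bitSum_mul (k : ℕ) (c : ℝ) (f : List Bool → ℝ) :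
    bitSum k (fun r => c * f r) = c * bitSum k f := by
  induction k generalizing f with
  | zero => rfl
  | succ k ih => simp only [bitSum, ih]; ring

theorem bitSum_sum {ι : Type*} (s : Finset ι) (k : ℕ) (f : ι → List Bool → ℝ) :
    bitSum k (fun r => ∑ i ∈ s, f i r) = ∑ i ∈ s, bitSum k (f i) := by
  induction k generalizing f with
  | zero => rfl
  | succ k ih => simp only [bitSum, ih, Finset.sum_add_distrib]

/-! ### Potential argument for predictors of bits. -/

section Predictor

variable (g : List Bool → ℝ) (d : Bool)

/-- The expected number of correct guesses on the bits `r`, after the bits `pre`, of a predictor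
that guesses the next bit to be `d` with probability `g b` after having seen `b`. -/
def guessScore : List Bool → List Bool → ℝ
  | _, [] => 0
  | pre, c :: r => (if c = d then g pre else 1 - g pre) + guessScore (pre ++ [c]) r

/-- A multiplicative potential dominating `2 ^ guessScore`. -/
def guessWeight : List Bool → List Bool → ℝ
  | _, [] => 1
  | pre, c :: r => (1 + if c = d then g pre else 1 - g pre) * guessWeight (pre ++ [c]) r

/-- The factors for the two values of a bit add up to `(1 + g) + (1 + (1 - g)) = 3`, whatever the
predictor does. -/
theorem bitSum_guessWeight (k : ℕ) (pre : List Bool) :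
    bitSum k (guessWeight g d pre) = 3 ^ k := by
  induction k generalizing pre with
  | zero => rfl
  | succ k ih =>
    simp only [bitSum, guessWeight, bitSum_mul, ih]
    cases d <;> simp <;> ring

theorem two_rpow_guessScore_le (h0 : ∀ b, 0 ≤ g b) (h1 : ∀ b, g b ≤ 1) (pre r : List Bool) :
    (2 : ℝ) ^ guessScore g d pre r ≤ guessWeight g d pre r := by
  induction r generalizing pre with
  | nil => simp [guessScore, guessWeight]
  | cons c r ih =>
    rw [guessScore, guessWeight, Real.rpow_add two_pos]
    -- Bernoulli's inequality for exponents in `[0, 1]`.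
    have key : ∀ x : ℝ, 0 ≤ x → x ≤ 1 → (2 : ℝ) ^ x ≤ 1 + x := fun x hx0 hx1 => by
      have := rpow_one_add_le_one_add_mul_self (s := 1) (by norm_num) hx0 hx1
      norm_num at this
      exact this
    have hx : 0 ≤ (if c = d then g pre else 1 - g pre) ∧
        (if c = d then g pre else 1 - g pre) ≤ 1 := by
      have h0 := h0 pre
      have h1 := h1 pre
      split_ifs <;> constructor <;> linarith
    exact mul_le_mul (key _ hx.1 hx.2) (ih _) (by positivity) (by linarith)

end Predictor

/-- Lower bound for augmented indexing: an algorithm that, given a code `x a` of a string `a` of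
`k` bits followed by a query `y b` about a proper prefix `b` of `a`, determines the bit of `a`
after `b`, has at least `2 ^ (k / 15)` states. -/
theorem le_log_card_of_augmentedIndex {σ : Type*} [Finite σ] {P : ProbAutomaton α σ}
    {K : Language α} (hP : P.IsFor K (1 / 3)) (k : ℕ) (d : Bool) (x y : List Bool → List α)
    (h : ∀ b c r, b.length + 1 + r.length = k → (x (b ++ c :: r) ++ y b ∈ K ↔ c = d)) :
    (k : ℝ) / 15 ≤ Real.logb 2 (Nat.card σ) := by
  have := Fintype.ofFinite σ
  rw [P.isFor_iff] at hP
  let g : σ → List Bool → ℝ := fun q b => P.acceptFrom (y b) q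
  have hg0 : ∀ q b, 0 ≤ g q b := fun q b => ProbAutomaton.acceptProb_nonneg _ _
  have hg1 : ∀ q b, g q b ≤ 1 := fun q b => ProbAutomaton.acceptProb_le_one _ _
  -- Each memory state is a predictor. Averaged over the state after `x a`, every bit is guessed
  -- correctly with probability at least `2 / 3`.
  have hscore : ∀ r pre a : List Bool, a = pre ++ r → a.length = k →
      2 / 3 * (r.length : ℝ) ≤ ∑ q, (P.dist (x a) q).toReal * guessScore (g q) d pre r := by
    intro r
    induction r with
    | nil => intro pre a _ _; simp [guessScore]
    | cons c r ih =>
      intro pre a ha hk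
      have h1 := ih (pre ++ [c]) a (by simp [ha]) hk
      simp only [guessScore, mul_add, Finset.sum_add_distrib, List.length_cons, Nat.cast_add,
        Nat.cast_one]
      have h2 : 2 / 3 ≤ ∑ q, (P.dist (x a) q).toReal * if c = d then g q pre else 1 - g q pre := by
        have hacc := P.acceptProb_append (x a) (y pre)
        have hmem := h pre c r (by rw [← hk, ha]; simp; omega)
        rw [← ha] at hmem
        by_cases hc : c = d
        · simp only [if_pos hc]
          have := hP.1 _ (hmem.2 hc)
          simp only [g, ← hacc]
          linarith
        · simp only [if_neg hc, mul_sub, mul_one, Finset.sum_sub_distrib, g, ← hacc, P.sum_dist]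
          have := hP.2 _ (fun hh => hc (hmem.1 hh))
          linarith
      linarith
  have hne : Nonempty σ := ⟨P.init.support_nonempty.some⟩
  -- Some state scores at least the average. This state depends on `a`, so the sum over all states
  -- is taken as an upper bound.
  have hweight : ∀ a : List Bool, a.length = k →
      (2 : ℝ) ^ (2 / 3 * (k : ℝ)) ≤ ∑ q, guessWeight (g q) d [] a := by
    intro a ha
    obtain ⟨q, hq⟩ := Finite.exists_max fun q => guessScore (g q) d [] a
    have h1 : 2 / 3 * (k : ℝ) ≤ guessScore (g q) d [] a := by
      rw [← ha]
      refine (hscore a [] a rfl ha).trans ?_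
      calc _ ≤ ∑ q', (P.dist (x a) q').toReal * guessScore (g q) d [] a :=
            Finset.sum_le_sum fun q' _ => mul_le_mul_of_nonneg_left (hq q') ENNReal.toReal_nonneg
        _ = _ := by rw [← Finset.sum_mul, P.sum_dist, one_mul]
    have hw : ∀ q, (2 : ℝ) ^ guessScore (g q) d [] a ≤ guessWeight (g q) d [] a := fun q =>
      two_rpow_guessScore_le _ _ (hg0 q) (hg1 q) _ _
    calc (2 : ℝ) ^ (2 / 3 * (k : ℝ)) ≤ (2 : ℝ) ^ guessScore (g q) d [] a :=
          Real.rpow_le_rpow_of_exponent_le one_le_two h1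
      _ ≤ _ := hw q
      _ ≤ _ := Finset.single_le_sum (f := fun q => guessWeight (g q) d [] a)
        (fun q _ => (Real.rpow_nonneg two_pos.le _).trans (hw q)) (Finset.mem_univ q)
  have hmain : (2 : ℝ) ^ k * (2 : ℝ) ^ (2 / 3 * (k : ℝ)) ≤ Nat.card σ * 3 ^ k := by
    have := bitSum_mono hweight
    rw [bitSum_const, bitSum_sum] at this
    simpa [bitSum_guessWeight] using this
  have hcard : (0 : ℝ) < Nat.card σ := by exact_mod_cast Nat.card_pos
  have hlog := Real.logb_le_logb_of_le one_lt_two (by positivity) hmain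
  rw [Real.logb_mul (by positivity) (by positivity), Real.logb_mul (by positivity) (by positivity),
    Real.logb_pow, Real.logb_pow, Real.logb_rpow two_pos (by norm_num), Real.logb_self_eq_one
    one_lt_two] at hlog
  -- The constant arises as `1 + 2 / 3 - 8 / 5 = 1 / 15`.
  have h3 : Real.logb 2 3 ≤ 8 / 5 := by
    have h5 := Real.logb_le_logb_of_le one_lt_two (by norm_num) (show (3 : ℝ) ^ 5 ≤ 2 ^ 8 by norm_num)
    rw [Real.logb_pow, Real.logb_pow, Real.logb_self_eq_one one_lt_two] at h5
    push_cast at h5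
    linarith
  nlinarith [mul_le_mul_of_nonneg_left h3 (Nat.cast_nonneg (α := ℝ) k)]

/-- The value of a bit string, most significant bit first. -/
def bitVal : List Bool → ℕ
  | [] => 0
  | c :: r => (if c then 2 ^ r.length else 0) + bitVal r

theorem bitVal_lt (r : List Bool) : bitVal r < 2 ^ r.length := by
  induction r with
  | nil => simp [bitVal]
  | cons c r ih =>
    simp only [bitVal, List.length_cons, pow_succ]
    split_ifs <;> omega

theorem bitVal_append (b r : List Bool) : bitVal (b ++ r) = bitVal b * 2 ^ r.length + bitVal r := by
  induction b with
  | nil => simp [bitVal]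
  | cons c b ih =>
    simp only [bitVal, List.cons_append, ih, List.length_append, pow_add]
    split_ifs <;> ring

/-- Lower bound for the comparison of numbers below `2 ^ k`. -/
theorem le_log_card_of_greaterThan {σ : Type*} [Finite σ] {P : ProbAutomaton α σ}
    {K : Language α} (hP : P.IsFor K (1 / 3)) (k : ℕ) (d : Bool) (x y : ℕ → List α)
    (h : ∀ i θ, i < 2 ^ k → θ ≤ 2 ^ k → (x i ++ y θ ∈ K ↔ (θ ≤ i ↔ d = true))) :
    (k : ℝ) / 15 ≤ Real.logb 2 (Nat.card σ) := by
  -- Binary search: the threshold is the midpoint of the interval of numbers whose binary expansion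
  -- starts with `b`, so the comparison reveals the next bit.
  refine le_log_card_of_augmentedIndex hP k d (fun a => x (bitVal a))
    (fun b => y (bitVal b * 2 ^ (k - b.length) + 2 ^ (k - b.length - 1))) fun b c r hk => ?_
  have hb := bitVal_lt b
  have hr := bitVal_lt r
  obtain ⟨e1, e2⟩ : k - b.length - 1 = r.length ∧ k - b.length = r.length + 1 := by omega
  have hle : (bitVal b + 1) * 2 ^ (r.length + 1) ≤ 2 ^ b.length * 2 ^ (r.length + 1) :=
    Nat.mul_le_mul_right _ hb
  have hk2 : 2 ^ b.length * 2 ^ (r.length + 1) = 2 ^ k := by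
    rw [← pow_add]; congr 1; omega
  have hval : bitVal (b ++ c :: r) = bitVal b * 2 ^ (r.length + 1) +
      ((if c then 2 ^ r.length else 0) + bitVal r) := by
    rw [bitVal_append]; rfl
  have hpow : 2 ^ (r.length + 1) = 2 * 2 ^ r.length := pow_succ' _ _
  have hmul : (bitVal b + 1) * 2 ^ (r.length + 1) = bitVal b * 2 ^ (r.length + 1) +
      2 ^ (r.length + 1) := by ring
  rw [e1, e2, h, hval]
  · cases c <;> cases d <;> simp <;> omega
  · rw [hval]; split_ifs <;> omega
  · omega

/-- An algorithm with `m` states distinguishes at most `(6 * m + 1) ^ m` words. -/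
theorem card_le_of_distinguishable {σ : Type*} [Finite σ] {P : ProbAutomaton α σ}
    {K : Language α} (hP : P.IsFor K (1 / 3)) (N : ℕ) (x : ℕ → List α)
    (h : ∀ i j, i < j → j < N → ∃ y, ¬ (x i ++ y ∈ K ↔ x j ++ y ∈ K)) :
    N ≤ (6 * Nat.card σ + 1) ^ Nat.card σ := by
  have := Fintype.ofFinite σ
  have hne : Nonempty σ := ⟨P.init.support_nonempty.some⟩
  rw [P.isFor_iff] at hP
  set m := Nat.card σ with hm
  have hm0 : 0 < m := Nat.card_pos
  have hm0' : (0 : ℝ) < m := by exact_mod_cast hm0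
  have hle1 : ∀ w q, (P.dist w q).toReal ≤ 1 := fun w q =>
    ENNReal.toReal_mono ENNReal.one_ne_top (PMF.coe_le_one _ _)
  -- Round each state probability down to a multiple of `1 / (6 * m)`. Words with equal roundings
  -- have acceptance probabilities within `1 / 6` after every continuation, less than the gap `1 /
  -- 3` between acceptance and rejection.
  let φ : Fin N → σ → Fin (6 * m + 1) := fun i q =>
    ⟨⌊6 * m * (P.dist (x i) q).toReal⌋₊, by
      rw [Nat.lt_succ_iff]
      refine Nat.floor_le_of_le ?_
      push_cast
      exact mul_le_of_le_one_right (by positivity) (hle1 _ _)⟩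
  have hclose : ∀ i j, φ i = φ j → ∀ y, P.acceptProb (x i ++ y) ≤ P.acceptProb (x j ++ y) + 1 / 6 := by
    intro i j hij y
    rw [P.acceptProb_append, P.acceptProb_append]
    have hq : ∀ q, (P.dist (x i) q).toReal * P.acceptFrom y q ≤
        (P.dist (x j) q).toReal * P.acceptFrom y q + 1 / (6 * m) := by
      intro q
      have h1 : ⌊6 * m * (P.dist (x i) q).toReal⌋₊ = ⌊6 * m * (P.dist (x j) q).toReal⌋₊ :=
        congrArg Fin.val (congrFun hij q)
      have h2 := Nat.lt_floor_add_one (6 * m * (P.dist (x i) q).toReal)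
      have h3 := Nat.floor_le (show 0 ≤ 6 * m * (P.dist (x j) q).toReal by positivity)
      rw [h1] at h2
      have h4 : (P.dist (x i) q).toReal ≤ (P.dist (x j) q).toReal + 1 / (6 * m) := by
        rw [← sub_le_iff_le_add', le_div_iff₀ (by positivity)]
        nlinarith
      have h5 : 0 ≤ P.acceptFrom y q := ProbAutomaton.acceptProb_nonneg _ _
      have h6 : P.acceptFrom y q ≤ 1 := ProbAutomaton.acceptProb_le_one _ _
      calc _ ≤ ((P.dist (x j) q).toReal + 1 / (6 * m)) * P.acceptFrom y q := by gcongr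
        _ ≤ _ := by
          rw [add_mul]
          gcongr
          exact mul_le_of_le_one_right (by positivity) h6
    refine (Finset.sum_le_sum fun q _ => hq q).trans ?_
    rw [Finset.sum_add_distrib, Finset.sum_const, Finset.card_univ, ← Nat.card_eq_fintype_card,
      ← hm, nsmul_eq_mul]
    apply le_of_eq
    field_simp
  have hinj : Function.Injective φ := by
    have key : ∀ i j : Fin N, i < j → φ i ≠ φ j := by
      intro i j hlt hij
      obtain ⟨y, hy⟩ := h i j hlt j.2
      have h1 := hclose i j hij y
      have h2 := hclose j i hij.symm y
      by_cases hi : x i ++ y ∈ K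
      · have hj : x j ++ y ∉ K := fun hj => hy (iff_of_true hi hj)
        linarith [hP.1 _ hi, hP.2 _ hj]
      · have hj : x j ++ y ∈ K := by
          by_contra hj; exact hy (iff_of_false hi hj)
        linarith [hP.1 _ hj, hP.2 _ hi]
    intro i j hij
    rcases lt_trichotomy i j with hlt | rfl | hlt
    · exact absurd hij (key _ _ hlt)
    · rfl
    · exact absurd hij.symm (key _ _ hlt)
  have := Nat.card_le_card_of_injective φ hinj
  rwa [Nat.card_fun, Nat.card_fin, Nat.card_fin, ← hm] at this

/-! ### Lower bounds on the space complexity -/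

theorem le_randSpace [Finite α] {pad : α} {L : Language α} {n : ℕ} {s : ℝ}
    (h : ∀ (σ : Type) (_ : Finite σ) (P : ProbAutomaton α σ), P.IsFor (SW pad n L) (1 / 3) →
      s ≤ Real.logb 2 (Nat.card σ)) : s ≤ randSpace pad L n := by
  -- Nonemptiness is essential: the infimum of the empty set would be `0`.
  refine le_csInf (spaceSet_nonempty pad L n) ?_
  rintro _ ⟨σ, hσ, P, hP, rfl⟩
  exact h σ hσ P hP

theorem lastN_of_le {pad : α} {n : ℕ} {x : List α} (h : n ≤ x.length) :
    lastN pad n x = x.rtake n := by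
  simp [lastN, Nat.sub_eq_zero_of_le h]

theorem mem_SW_of_le {σ : Type*} {M : DFA α σ} {L : Language α} (hM : M.accepts = L.reverse)
    {pad : α} {n : ℕ} {x : List α} (h : n ≤ x.length) :
    x ∈ SW pad n L ↔ M.eval (x.reverse.take n) ∈ M.accept := by
  change lastN pad n x ∈ L ↔ M.eval (x.reverse.take n) ∈ M.accept
  rw [lastN_of_le h, ← Language.reverse_mem_reverse, ← hM, List.rtake_eq_reverse_take_reverse,
    List.reverse_reverse]
  rfl

/-- The window when the reversed stream starts with a word `w` of length `n`. -/
theorem reverse_append_mem_SW {σ : Type*} {M : DFA α σ} {L : Language α}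
    (hM : M.accepts = L.reverse) {pad : α} {n : ℕ} {x y w : List α} (hn : w.length = n)
    (h : w <+: y ++ x) :
    x.reverse ++ y.reverse ∈ SW pad n L ↔ M.eval w ∈ M.accept := by
  rw [mem_SW_of_le hM]
  · rw [← List.reverse_append, List.reverse_reverse, ← hn, ← List.prefix_iff_eq_take.1 h]
  · rw [← hn, ← List.reverse_append, List.length_reverse]
    exact h.length_le

theorem omegaBar_of_forall {f g : ℕ → ℝ} {c : ℝ} (hc : 0 < c) (k₀ : ℕ)
    (h : ∀ k ≥ k₀, ∃ n ≥ k, c * g n ≤ f n) : OmegaBar f g := by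
  refine ⟨c, hc, frequently_atTop.2 fun k => ?_⟩
  obtain ⟨n, hn, hfg⟩ := h (max k k₀) (le_max_right _ _)
  exact ⟨n, (le_max_left _ _).trans hn, hfg⟩

/-- Repetition of a word. -/
def rep (v : List α) (j : ℕ) : List α := (List.replicate j v).flatten

theorem rep_add (v : List α) (i j : ℕ) : rep v (i + j) = rep v i ++ rep v j := by
  rw [rep, rep, rep, ← List.flatten_append, List.replicate_append_replicate]

@[simp] theorem length_rep (v : List α) (j : ℕ) : (rep v j).length = j * v.length := by
  simp [rep]

theorem rep_prefix_rep {v : List α} {i j : ℕ} (h : i ≤ j) : rep v i <+: rep v j := by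
  obtain ⟨e, rfl⟩ := Nat.exists_eq_add_of_le h
  exact ⟨rep v e, (rep_add v i e).symm⟩

theorem evalFrom_rep {σ : Type} {M : DFA α σ} {p : σ} {v : List α} (h : M.evalFrom p v = p)
    (j : ℕ) : M.evalFrom p (rep v j) = p :=
  evalFrom_flatten_replicate M h j

theorem eval_append_rep_append {σ : Type} (M : DFA α σ) {y v : List α}
    (h : M.evalFrom (M.eval y) v = M.eval y) (j : ℕ) (t : List α) :
    M.eval (y ++ (rep v j ++ t)) = M.evalFrom (M.eval y) t := by
  rw [eval_append, DFA.evalFrom_of_append, evalFrom_rep h]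

/-- A word that starts with `s` and is a cycle, repeated more than `K` times. -/
theorem rep_append_prefix {v s : List α} (hs : s <+: v) {K j : ℕ} (hj : K < j) :
    rep v K ++ s <+: rep v j := by
  refine List.IsPrefix.trans ?_ (rep_prefix_rep hj)
  rw [Nat.succ_eq_add_one, rep_add]
  refine (List.prefix_append_right_inj _).2 ?_
  simpa [rep] using hs

/-- If two words of equal length lead from a reachable state to states of its strongly connected
component of which exactly one is accepting, the space is linear. -/
theorem omegaBar_linear [Finite α] (pad : α) {σ : Type} (M : DFA α σ) {L : Language α}
    (hM : M.accepts = L.reverse) {y u v u' v' : List α} (huv : u.length = v.length)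
    (hu : M.evalFrom (M.eval y) (u ++ u') = M.eval y)
    (hv : M.evalFrom (M.eval y) (v ++ v') = M.eval y)
    (hua : M.evalFrom (M.eval y) u ∈ M.accept) (hva : M.evalFrom (M.eval y) v ∉ M.accept) :
    OmegaBar (randSpace pad L) (fun n => (n : ℝ)) := by
  have hu0 : u ≠ [] := by
    rintro rfl
    obtain rfl : v = [] := List.length_eq_zero_iff.1 huv.symm
    exact hva hua
  have hul := List.length_pos_iff.2 hu0
  -- Each cycle is repeated as often as the other one is long, which makes the lengths equal.
  obtain ⟨U, V, hU, hV, hUV, huU, hvV⟩ : ∃ U V : List α, M.evalFrom (M.eval y) U = M.eval y ∧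
      M.evalFrom (M.eval y) V = M.eval y ∧ U.length = V.length ∧ u <+: U ∧ v <+: V := by
    refine ⟨rep (u ++ u') (v ++ v').length, rep (v ++ v') (u ++ u').length,
      evalFrom_rep hu _, evalFrom_rep hv _, by simp only [length_rep]; ring, ?_, ?_⟩
    · have := rep_append_prefix (v := u ++ u') (List.prefix_append u u')
        (K := 0) (j := (v ++ v').length) (by simp; omega)
      simpa [rep] using this
    · have := rep_append_prefix (v := v ++ v') (List.prefix_append v v')
        (K := 0) (j := (u ++ u').length) (by simp; omega)
      simpa [rep] using this
  set l := U.length with hl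
  have hul' : u.length ≤ l := huU.length_le
  let block : Bool → List α := fun c => if c then U else V
  have hblock : ∀ c, (block c).length = l := fun c => by cases c <;> simp [block, ← hUV, ← hl]
  let code : List Bool → List α := fun a => a.flatMap block
  have hcode : ∀ a, (code a).length = a.length * l := fun a => by
    induction a with
    | nil => simp [code]
    | cons c a ih =>
      simp only [code, List.flatMap_cons, List.length_append, List.length_cons] at ih ⊢
      rw [ih, hblock]; ring
  have heval : ∀ a, M.evalFrom (M.eval y) (code a) = M.eval y := fun a => by
    induction a with
    | nil => rfl
    | cons c a ih =>
      have : M.evalFrom (M.eval y) (block c) = M.eval y := by cases c <;> simp [block, hU, hV]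
      simp only [code, List.flatMap_cons] at ih ⊢
      rw [DFA.evalFrom_of_append, this, ih]
  have hD : (0 : ℝ) < 15 * (y.length + l + u.length) := by
    have : (0 : ℝ) < u.length := by exact_mod_cast hul
    positivity
  refine omegaBar_of_forall (c := 1 / (15 * (y.length + l + u.length))) (by positivity) 1
    fun k hk => ⟨y.length + k * l + u.length, by nlinarith, ?_⟩
  refine le_trans ?_ (le_randSpace (s := (k : ℝ) / 15) fun σ _ P hP =>
    le_log_card_of_augmentedIndex hP k true (fun a => (code a).reverse)
      (fun b => (y ++ rep U (k - b.length)).reverse) fun b c r hbr => ?_)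
  · rw [one_div_mul_eq_div, div_le_div_iff₀ hD (by norm_num)]
    have hk' : (1 : ℝ) ≤ k := by exact_mod_cast hk
    push_cast
    nlinarith [mul_le_mul_of_nonneg_right hk' (Nat.cast_nonneg (α := ℝ) y.length),
      mul_le_mul_of_nonneg_right hk' (Nat.cast_nonneg (α := ℝ) u.length)]
  · let t : List α := if c then u else v
    have ht : t <+: block c := by cases c <;> simp [t, block, huU, hvV]
    have htl : t.length = u.length := by cases c <;> simp [t, huv]
    -- The reversed stream is `y`, then `k - b.length` copies of `U`, then the code of the whole bit
    -- string. The copies of `U` make up for the length of `b`, so the window always ends `u.length`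
    -- symbols into the block of the queried bit, after `u` or `v`.
    rw [reverse_append_mem_SW hM (w := y ++ (rep U (k - b.length) ++ (code b ++ t)))]
    · rw [eval_append_rep_append M hU, DFA.evalFrom_of_append, heval]
      cases c <;> simp [t, hua, hva]
    · simp only [List.length_append, length_rep, hcode, htl, ← hl]
      have : k = (k - b.length) + b.length := by omega
      conv_rhs => rw [this]
      ring
    · simp only [code, List.flatMap_append, List.flatMap_cons, List.append_assoc]
      refine (List.prefix_append_right_inj _).2 ((List.prefix_append_right_inj _).2
        ((List.prefix_append_right_inj _).2 (ht.trans (List.prefix_append _ _))))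

/-! ### Conflicts between words of equal length from a recurrent state. -/

section Fork

variable {σ : Type} [Fintype σ] (M : DFA α σ)

/-- Two words `t`, `t'` of equal length which lead from the recurrent state `M.eval y` to states
of different acceptance can be replaced by one of them and a prefix of an arbitrarily long
cycle. -/
theorem exists_fork {y t t' : List α} (hy : Recurrent M (M.eval y)) (htt : t.length = t'.length)
    (hta : M.evalFrom (M.eval y) t ∈ M.accept) (hta' : M.evalFrom (M.eval y) t' ∉ M.accept) :
    ∃ v s e : List α, ∃ d : Bool, v ≠ [] ∧ M.evalFrom (M.eval y) v = M.eval y ∧ s <+: v ∧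
      s.length = e.length ∧ (e = t ∨ e = t') ∧
      (M.evalFrom (M.eval y) s ∈ M.accept ↔ d = true) ∧
      (M.evalFrom (M.eval y) e ∈ M.accept ↔ d = false) ∧
      ∀ q, Recurrent M q → ∃ f, f.length = v.length ∧ M.evalFrom q f = q := by
  obtain ⟨P, hP, hper⟩ := exists_common_period M
  have hd : P ∣ P * (t.length + 1) := dvd_mul_right _ _
  obtain ⟨v, hvl, hv⟩ := hper _ hy _ hd
  have hvt : t.length + 1 ≤ v.length := by rw [hvl]; exact Nat.le_mul_of_pos_left _ hP
  have hs : (v.take t.length).length = t.length := by simp; omega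
  have hv0 : v ≠ [] := by rintro rfl; simp at hvt
  have hcyc : ∀ q, Recurrent M q → ∃ f, f.length = v.length ∧ M.evalFrom q f = q := fun q hq => by
    rw [hvl]; exact hper q hq _ hd
  -- The prefix `s` of the cycle disagrees in acceptance with exactly one of `t` and `t'`; that one
  -- becomes `e`.
  by_cases hacc : M.evalFrom (M.eval y) (v.take t.length) ∈ M.accept
  · exact ⟨v, v.take t.length, t', true, hv0, hv, List.take_prefix _ _, hs.trans htt, Or.inr rfl,
      by simp [hacc], by simp [hta'], hcyc⟩
  · exact ⟨v, v.take t.length, t, false, hv0, hv, List.take_prefix _ _, hs, Or.inl rfl,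
      by simp [hacc], by simp [hta], hcyc⟩

theorem omegaBar_log2 [Finite α] (pad : α) {L : Language α}
    (hM : M.accepts = L.reverse) {y t t' : List α} (hy : Recurrent M (M.eval y))
    (htt : t.length = t'.length) (ht : Recurrent M (M.evalFrom (M.eval y) t))
    (ht' : Recurrent M (M.evalFrom (M.eval y) t'))
    (hta : M.evalFrom (M.eval y) t ∈ M.accept) (hta' : M.evalFrom (M.eval y) t' ∉ M.accept) :
    OmegaBar (randSpace pad L) log2 := by
  obtain ⟨v, s, e, d, hv0, hv, hsv, hse, he, hsd, hed, hcyc⟩ := exists_fork M hy htt hta hta'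
  have her : Recurrent M (M.evalFrom (M.eval y) e) := by rcases he with rfl | rfl <;> assumption
  obtain ⟨f, hfl, hf⟩ := hcyc _ her
  have hvl := List.length_pos_iff.2 hv0
  have hsv' := hsv.length_le
  set D := y.length + v.length + e.length with hDdef
  have hD : (1 : ℝ) ≤ D := by exact_mod_cast (by omega : 1 ≤ D)
  have hlogD : 0 ≤ Real.logb 2 D := Real.logb_nonneg one_lt_two hD
  refine omegaBar_of_forall (c := 1 / (15 * (Real.logb 2 D + 1))) (by positivity) 1
    fun k hk => ⟨y.length + 2 ^ k * v.length + e.length, ?_, ?_⟩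
  · have : k < 2 ^ k := Nat.lt_two_pow_self
    nlinarith
  -- The reversed stream is `y`, then `2 ^ k + 1 - θ + i` copies of `v`, then `e` and copies of `f`.
  -- The window covers `y`, `2 ^ k` copies of `v` and `e.length` further symbols. It ends with `s`
  -- inside the cycles if `θ ≤ i`; otherwise it contains all of `e` and ends after a whole number of
  -- copies of `f`, which keep the state reached by `e`.
  refine le_trans ?_ (le_randSpace (s := (k : ℝ) / 15) fun σ _ P hP =>
    le_log_card_of_greaterThan hP k d (fun i => (rep v i ++ (e ++ rep f (2 ^ k))).reverse)
      (fun θ => (y ++ rep v (2 ^ k + 1 - θ)).reverse) fun i θ hi hθ => ?_)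
  · have hk' : (1 : ℝ) ≤ k := by exact_mod_cast hk
    have hn : (y.length + 2 ^ k * v.length + e.length : ℕ) ≤ D * 2 ^ k := by
      have : 1 ≤ 2 ^ k := Nat.one_le_two_pow
      rw [hDdef]; nlinarith
    have hlog : log2 (y.length + 2 ^ k * v.length + e.length) ≤ Real.logb 2 D + k := by
      have h1 : ((y.length + 2 ^ k * v.length + e.length : ℕ) : ℝ) ≤ D * 2 ^ k := by
        exact_mod_cast hn
      have h2 := Real.logb_le_logb_of_le one_lt_two (by positivity) h1
      rwa [Real.logb_mul (by positivity) (by positivity), Real.logb_pow,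
        Real.logb_self_eq_one one_lt_two, mul_one] at h2
    rw [one_div_mul_eq_div, div_le_div_iff₀ (by positivity) (by norm_num)]
    nlinarith
  · by_cases hiθ : θ ≤ i
    · rw [reverse_append_mem_SW hM (w := y ++ (rep v (2 ^ k) ++ s))]
      · rw [eval_append_rep_append M hv, hsd]; simp [hiθ]
      · simp [hse]; ring
      · rw [List.append_assoc, ← List.append_assoc (rep v _), ← rep_add]
        refine (List.prefix_append_right_inj _).2
          ((rep_append_prefix hsv ?_).trans (List.prefix_append _ _))
        omega
    · obtain ⟨j, hj⟩ : ∃ j, 2 ^ k = (2 ^ k + 1 - θ + i) + j := ⟨θ - 1 - i, by omega⟩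
      rw [reverse_append_mem_SW hM (w := y ++ (rep v (2 ^ k + 1 - θ + i) ++ (e ++ rep f j)))]
      · rw [eval_append_rep_append M hv, DFA.evalFrom_of_append, evalFrom_rep hf, hed]
        simp [hiθ]
      · simp only [List.length_append, length_rep, hfl]
        conv_rhs => rw [hj]
        ring
      · rw [rep_add, List.append_assoc, List.append_assoc]
        exact (List.prefix_append_right_inj _).2 ((List.prefix_append_right_inj _).2
          ((List.prefix_append_right_inj _).2 ((List.prefix_append_right_inj _).2
            (rep_prefix_rep (by omega)))))

theorem omegaBar_loglog2 [Finite α] (pad : α) {L : Language α}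
    (hM : M.accepts = L.reverse) {y t t' : List α} (hy : Recurrent M (M.eval y))
    (htt : t.length = t'.length)
    (hta : M.evalFrom (M.eval y) t ∈ M.accept) (hta' : M.evalFrom (M.eval y) t' ∉ M.accept) :
    OmegaBar (randSpace pad L) loglog2 := by
  obtain ⟨v, s, e, d, hv0, hv, hsv, hse, he, hsd, hed, hcyc⟩ := exists_fork M hy htt hta hta'
  have hvl := List.length_pos_iff.2 hv0
  have hsv' := hsv.length_le
  set D := y.length + v.length + e.length with hDdef
  have hD : (1 : ℝ) ≤ D := by exact_mod_cast (by omega : 1 ≤ D)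
  have hlogD : 0 ≤ Real.logb 2 D := Real.logb_nonneg one_lt_two hD
  set E := Real.logb 2 (Real.logb 2 D + 1)
  have hE : 0 ≤ E := Real.logb_nonneg one_lt_two (by linarith)
  refine omegaBar_of_forall (c := 1 / (4 * (E + 1))) (by positivity) 6
    -- The bound below is `k ≤ 3 + 2 * log m`, and `(k - 3) / 2 ≥ k / 4` holds from `k = 6` on.
    fun k hk => ⟨y.length + 2 ^ 2 ^ k * v.length + e.length, ?_, ?_⟩
  · have : k < 2 ^ k := Nat.lt_two_pow_self
    have : 2 ^ k < 2 ^ 2 ^ k := Nat.lt_two_pow_self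
    nlinarith
  have hk' : (6 : ℝ) ≤ k := by exact_mod_cast hk
  set N := 2 ^ 2 ^ k with hN
  refine le_trans ?_ (le_randSpace (s := (k : ℝ) / 4) fun σ _ P hP => ?_)
  · have hN1 : 2 ≤ N := Nat.le_self_pow (by positivity) 2
    have hn : (y.length + N * v.length + e.length : ℕ) ≤ D * N := by
      rw [hDdef]; nlinarith
    have hn2 : 2 ≤ y.length + N * v.length + e.length := by nlinarith
    have hlog1 : 1 ≤ Real.logb 2 (y.length + N * v.length + e.length : ℕ) := by
      rw [Real.le_logb_iff_rpow_le one_lt_two (by positivity), Real.rpow_one]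
      exact_mod_cast hn2
    have hlog : Real.logb 2 (y.length + N * v.length + e.length : ℕ) ≤
        (Real.logb 2 D + 1) * 2 ^ k := by
      have h1 : ((y.length + N * v.length + e.length : ℕ) : ℝ) ≤ D * 2 ^ 2 ^ k := by
        exact_mod_cast hn
      have h2 := Real.logb_le_logb_of_le one_lt_two (by positivity) h1
      rw [Real.logb_mul (by positivity) (by positivity), Real.logb_pow,
        Real.logb_self_eq_one one_lt_two, mul_one] at h2
      push_cast at h2 ⊢
      have h3 : (1 : ℝ) ≤ 2 ^ k := one_le_pow₀ one_le_two
      nlinarith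
    have hll : loglog2 (y.length + N * v.length + e.length) ≤ E + k := by
      have h2 := Real.logb_le_logb_of_le one_lt_two (by linarith) hlog
      rwa [Real.logb_mul (by positivity) (by positivity), Real.logb_pow,
        Real.logb_self_eq_one one_lt_two, mul_one] at h2
    rw [one_div_mul_eq_div, div_le_div_iff₀ (by positivity) (by norm_num)]
    nlinarith
  -- For `i < j`, prepending `y` and `N - i` copies of `v` to the reversed stream gives exactly `N`
  -- copies before `e` for `i`, but more than `N` for `j`. The window ends right after `e` in one
  -- case and after `s` in the other, so no cycle after `e` is needed.
  · have hcard := card_le_of_distinguishable hP (N + 1) (fun i => (rep v i ++ e).reverse)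
      fun i j hij hj => ⟨(y ++ rep v (N - i)).reverse, by
        rw [reverse_append_mem_SW hM (w := y ++ (rep v N ++ e)),
          reverse_append_mem_SW hM (w := y ++ (rep v N ++ s)),
          eval_append_rep_append M hv, eval_append_rep_append M hv, hsd, hed]
        · cases d <;> simp
        · simp [hse]; ring
        · rw [List.append_assoc, ← List.append_assoc (rep v _), ← rep_add]
          refine (List.prefix_append_right_inj _).2
            ((rep_append_prefix hsv ?_).trans (List.prefix_append _ _))
          omega
        · simp; ring
        · rw [List.append_assoc, ← List.append_assoc (rep v _), ← rep_add,
            Nat.sub_add_cancel (by omega)]⟩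
    have hne : Nonempty σ := ⟨P.init.support_nonempty.some⟩
    set m := Nat.card σ
    have hm0 : 0 < m := Nat.card_pos
    have hm1 : (1 : ℝ) ≤ m := by exact_mod_cast hm0
    have h1 : N ≤ 2 ^ ((6 * m + 1) * m) := by
      rw [pow_mul]
      exact (Nat.le_succ N).trans (hcard.trans (Nat.pow_le_pow_left Nat.lt_two_pow_self.le _))
    have h2 : 2 ^ k ≤ (6 * m + 1) * m := (Nat.pow_le_pow_iff_right (by norm_num)).1 h1
    have h3 : (2 : ℝ) ^ k ≤ 2 ^ 3 * (m : ℝ) ^ 2 := by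
      have : 2 ^ k ≤ 2 ^ 3 * m ^ 2 := by nlinarith
      exact_mod_cast this
    have h4 := Real.logb_le_logb_of_le one_lt_two (by positivity) h3
    rw [Real.logb_mul (by positivity) (by positivity), Real.logb_pow, Real.logb_pow,
      Real.logb_pow, Real.logb_self_eq_one one_lt_two] at h4
    push_cast at h4
    linarith

end Fork

/-! ### Constructions of probabilistic automata -/

namespace ProbAutomaton

variable {σ τ : Type*}

/-- The automaton with exchanged answers. -/
def compl (P : ProbAutomaton α σ) : ProbAutomaton α σ := { P with accept := P.acceptᶜ }

theorem IsFor.compl {P : ProbAutomaton α σ} {K : Language α} {ε : ℝ} (h : P.IsFor K ε) :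
    P.compl.IsFor Kᶜ ε := by
  refine ⟨fun w hw => h.2 w hw, fun w hw => ?_⟩
  have := h.1 w (by_contra hw)
  change 1 - ε ≤ ((P.dist w).toOuterMeasure P.acceptᶜᶜ).toReal
  rwa [compl_compl]

theorem IsFor.mono {P : ProbAutomaton α σ} {K : Language α} {ε δ : ℝ} (h : P.IsFor K ε)
    (hε : ε ≤ δ) : P.IsFor K δ :=
  ⟨fun w hw => by linarith [h.1 w hw], fun w hw => by linarith [h.2 w hw]⟩

/-- Independent parallel execution, accepting if both automata do. -/
noncomputable def prod (P : ProbAutomaton α σ) (Q : ProbAutomaton α τ) :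
    ProbAutomaton α (σ × τ) where
  init := P.init.bind fun p => Q.init.map (Prod.mk p)
  step s a := (P.step s.1 a).bind fun p => (Q.step s.2 a).map (Prod.mk p)
  accept := {s | s.1 ∈ P.accept ∧ s.2 ∈ Q.accept}

theorem map_fst_prod (μ : PMF σ) (ν : PMF τ) :
    (μ.bind fun p => ν.map (Prod.mk p)).map Prod.fst = μ := by
  rw [PMF.map_bind]
  simp only [PMF.map_comp]
  exact (congrArg μ.bind (funext fun p => PMF.map_const ν p)).trans μ.bind_pure

theorem map_snd_prod (μ : PMF σ) (ν : PMF τ) :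
    (μ.bind fun p => ν.map (Prod.mk p)).map Prod.snd = ν := by
  rw [PMF.map_bind]
  simp only [PMF.map_comp]
  exact (congrArg μ.bind (funext fun p => PMF.map_id ν)).trans (μ.bind_const ν)

/-- The marginals of the product are the original distributions, so the error is bounded by a union
bound and independence plays no role. -/
theorem map_fst_dist_prod (P : ProbAutomaton α σ) (Q : ProbAutomaton α τ) (w : List α) :
    ((P.prod Q).dist w).map Prod.fst = P.dist w := by
  induction w using List.reverseRecOn with
  | nil => exact map_fst_prod _ _
  | append_singleton w a ih =>
    rw [dist_snoc, dist_snoc, PMF.map_bind, ← ih, PMF.bind_map]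
    exact congrArg _ (funext fun s => map_fst_prod _ _)

theorem map_snd_dist_prod (P : ProbAutomaton α σ) (Q : ProbAutomaton α τ) (w : List α) :
    ((P.prod Q).dist w).map Prod.snd = Q.dist w := by
  induction w using List.reverseRecOn with
  | nil => exact map_snd_prod _ _
  | append_singleton w a ih =>
    rw [dist_snoc, dist_snoc, PMF.map_bind, ← ih, PMF.bind_map]
    exact congrArg _ (funext fun s => map_snd_prod _ _)

theorem acceptProb_prod_le_left (P : ProbAutomaton α σ) (Q : ProbAutomaton α τ) (w : List α) :
    (P.prod Q).acceptProb w ≤ P.acceptProb w := by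
  rw [acceptProb, acceptProb, ← map_fst_dist_prod P Q, PMF.toOuterMeasure_map_apply]
  exact ENNReal.toReal_mono (PMF.toOuterMeasure_ne_top _ _)
    (MeasureTheory.measure_mono fun s hs => hs.1)

theorem acceptProb_prod_le_right (P : ProbAutomaton α σ) (Q : ProbAutomaton α τ) (w : List α) :
    (P.prod Q).acceptProb w ≤ Q.acceptProb w := by
  rw [acceptProb, acceptProb, ← map_snd_dist_prod P Q, PMF.toOuterMeasure_map_apply]
  exact ENNReal.toReal_mono (PMF.toOuterMeasure_ne_top _ _)
    (MeasureTheory.measure_mono fun s hs => hs.2)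

theorem rejectProb_prod_le (P : ProbAutomaton α σ) (Q : ProbAutomaton α τ) (w : List α) :
    (P.prod Q).rejectProb w ≤ P.rejectProb w + Q.rejectProb w := by
  rw [rejectProb, rejectProb, rejectProb, ← map_fst_dist_prod P Q, ← map_snd_dist_prod P Q,
    PMF.toOuterMeasure_map_apply, PMF.toOuterMeasure_map_apply,
    ← ENNReal.toReal_add (PMF.toOuterMeasure_ne_top _ _) (PMF.toOuterMeasure_ne_top _ _)]
  refine ENNReal.toReal_mono (ENNReal.add_ne_top.2 ⟨PMF.toOuterMeasure_ne_top _ _,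
    PMF.toOuterMeasure_ne_top _ _⟩) (le_trans (MeasureTheory.measure_mono fun s hs => ?_)
      (MeasureTheory.measure_union_le _ _))
  exact not_and_or.1 hs

theorem IsFor.inf {P : ProbAutomaton α σ} {Q : ProbAutomaton α τ} {K K' : Language α} {ε δ : ℝ}
    (hε : 0 ≤ ε) (hδ : 0 ≤ δ) (hP : P.IsFor K ε) (hQ : Q.IsFor K' δ) :
    (P.prod Q).IsFor (K ⊓ K') (ε + δ) := by
  rw [isFor_iff]
  refine ⟨fun w hw => ?_, fun w hw => ?_⟩
  · linarith [hP.1 w hw.1, hQ.1 w hw.2, rejectProb_prod_le P Q w, P.acceptProb_add_rejectProb w,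
      Q.acceptProb_add_rejectProb w, (P.prod Q).acceptProb_add_rejectProb w]
  · rcases not_and_or.1 hw with h | h
    · linarith [((P.isFor_iff _ _).1 hP).2 w h, acceptProb_prod_le_left P Q w]
    · linarith [((Q.isFor_iff _ _).1 hQ).2 w h, acceptProb_prod_le_right P Q w]

/-- Run one of finitely many automata, chosen uniformly at random. -/
noncomputable def mix {ι : Type*} [Fintype ι] [Nonempty ι] (P : ι → ProbAutomaton α σ) :
    ProbAutomaton α (ι × σ) where
  init := (PMF.uniformOfFintype ι).bind fun i => (P i).init.map (Prod.mk i)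
  step s a := ((P s.1).step s.2 a).map (Prod.mk s.1)
  accept := {s | s.2 ∈ (P s.1).accept}

theorem dist_mix {ι : Type*} [Fintype ι] [Nonempty ι] (P : ι → ProbAutomaton α σ) (w : List α) :
    (mix P).dist w =
      (PMF.uniformOfFintype ι).bind fun i => ((P i).dist w).map (Prod.mk i) := by
  induction w using List.reverseRecOn with
  | nil => rfl
  | append_singleton w a ih =>
    rw [dist_snoc, ih, PMF.bind_bind]
    refine congrArg _ (funext fun i => ?_)
    rw [PMF.bind_map, dist_snoc, PMF.map_bind]
    rfl

theorem acceptProb_mix {ι : Type*} [Fintype ι] [Nonempty ι] (P : ι → ProbAutomaton α σ)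
    (w : List α) : (mix P).acceptProb w = (∑ i, (P i).acceptProb w) / Fintype.card ι := by
  rw [acceptProb, dist_mix, PMF.toOuterMeasure_bind_apply, tsum_fintype,
    ENNReal.toReal_sum fun q _ => ENNReal.mul_ne_top (PMF.apply_ne_top _ _)
      (PMF.toOuterMeasure_ne_top _ _), Finset.sum_div]
  refine Finset.sum_congr rfl fun i _ => ?_
  rw [ENNReal.toReal_mul, PMF.uniformOfFintype_apply, PMF.toOuterMeasure_map_apply,
    ENNReal.toReal_inv, ENNReal.toReal_natCast, inv_mul_eq_div]
  rfl

end ProbAutomaton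

/-! ### Streams that are longer than the window -/

/-- Surplus padding lies outside the window. -/
theorem lastN_eq_rtake (pad : α) (n : ℕ) (w : List α) :
    lastN pad n w = (List.replicate n pad ++ w).rtake n := by
  have h : List.replicate n pad = List.replicate (n - (n - w.length)) pad ++
      List.replicate (n - w.length) pad := by
    rw [List.replicate_append_replicate]; congr 1; omega
  rw [h, lastN, List.rtake_eq_reverse_take_reverse, List.rtake_eq_reverse_take_reverse,
    List.append_assoc, List.reverse_append (as := List.replicate (n - (n - w.length)) pad),
    List.take_append_of_le_length]
  simp only [List.length_reverse, List.length_append, List.length_replicate]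
  omega

/-- It suffices to treat streams that are at least as long as the window. -/
theorem exists_isFor_SW {σ : Type} (pad : α) {L : Language α} {n : ℕ} {ε : ℝ}
    (P : ProbAutomaton α σ)
    (h1 : ∀ y : List α, n ≤ y.length → y.rtake n ∈ L → 1 - ε ≤ P.acceptProb y)
    (h0 : ∀ y : List α, n ≤ y.length → y.rtake n ∉ L → P.acceptProb y ≤ ε) :
    ∃ P' : ProbAutomaton α σ, P'.IsFor (SW pad n L) ε := by
  -- Reading `n` padding symbols in advance is absorbed into the initial distribution.
  refine ⟨{ P with init := P.dist (List.replicate n pad) }, ?_⟩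
  rw [ProbAutomaton.isFor_iff]
  have hacc : ∀ w, ({ P with init := P.dist (List.replicate n pad) } :
      ProbAutomaton α σ).acceptProb w = P.acceptProb (List.replicate n pad ++ w) := fun w => by
    simp [ProbAutomaton.acceptProb, ProbAutomaton.dist, List.foldl_append]
  refine ⟨fun w hw => ?_, fun w hw => ?_⟩
  · rw [hacc]
    exact h1 _ (by simp) (lastN_eq_rtake pad n w ▸ hw)
  · rw [hacc]
    exact h0 _ (by simp) (lastN_eq_rtake pad n w ▸ hw)

/-- A biased coin. -/
noncomputable def coin (r : NNReal) (hr : r ≤ 1) : PMF Bool :=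
  PMF.ofFintype (fun b => if b then (r : ENNReal) else 1 - r) (by
    simpa using add_tsub_cancel_of_le (by exact_mod_cast hr))

theorem coin_apply (r : NNReal) (hr : r ≤ 1) (b : Bool) :
    coin r hr b = if b then (r : ENNReal) else 1 - r :=
  PMF.ofFintype_apply _ _

/-! ### Counting the distance to the last occurrence -/

section Counter

variable {τ : Type} (M : DFA α τ)

open scoped Classical in
/-- The length of the shortest prefix of a word that leads from the given state to an accepting
one. -/
noncomputable def firstHit : List α → τ → Option ℕ
  | [], p => if p ∈ M.accept then some 0 else none
  | a :: z, p => if p ∈ M.accept then some 0 else (firstHit z (M.step p a)).map Nat.succ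

theorem firstHit_of_mem {z : List α} {p : τ} (hp : p ∈ M.accept) : firstHit M z p = some 0 := by
  cases z <;> simp [firstHit, hp]

theorem evalFrom_take_of_firstHit {z : List α} {p : τ} {c : ℕ} (h : firstHit M z p = some c) :
    c ≤ z.length ∧ M.evalFrom p (z.take c) ∈ M.accept := by
  induction z generalizing p c with
  | nil =>
    by_cases hp : p ∈ M.accept
    · simp only [firstHit, if_pos hp, Option.some.injEq] at h
      subst h; simpa using hp
    · simp [firstHit, hp] at h
  | cons a z ih =>
    by_cases hp : p ∈ M.accept
    · simp only [firstHit, if_pos hp, Option.some.injEq] at h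
      subst h; simpa using hp
    · simp only [firstHit, if_neg hp, Option.map_eq_some_iff] at h
      obtain ⟨c, hc, rfl⟩ := h
      simpa using ih hc

theorem exists_firstHit_le {z : List α} {p : τ} {j : ℕ}
    (h : M.evalFrom p (z.take j) ∈ M.accept) : ∃ c ≤ j, firstHit M z p = some c := by
  by_cases hp : p ∈ M.accept
  · exact ⟨0, Nat.zero_le _, firstHit_of_mem M hp⟩
  induction z generalizing p j with
  | nil => simp at h; exact absurd h hp
  | cons a z ih =>
    cases j with
    | zero => simp at h; exact absurd h hp
    | succ j =>
      rw [List.take_succ_cons, DFA.evalFrom_cons] at h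
      simp only [firstHit, if_neg hp]
      by_cases hp' : M.step p a ∈ M.accept
      · exact ⟨1, by omega, by rw [firstHit_of_mem M hp']; rfl⟩
      · obtain ⟨c, hc, hcz⟩ := ih h hp'
        exact ⟨c + 1, by omega, by rw [hcz]; rfl⟩

variable {V : Type} (f : V → V) (v₀ : V) (E : Set V) (r : NNReal) (hr : r ≤ 1)

open scoped Classical in
/-- For every state of `M`, store the value of `firstHit` on the reversed stream, represented by
the corresponding iterate of `f`; each stored value survives a step with probability `r`. -/
noncomputable def counter : ProbAutomaton α (τ → Option V) where
  init := PMF.pure fun p => if p ∈ M.accept then some v₀ else none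
  step s a := (coin r hr).map fun b p =>
    if p ∈ M.accept then some v₀ else if b then (s (M.step p a)).map f else none
  accept := {s | ∃ v ∈ E, s M.start = some v}

open scoped Classical in
-- A new symbol is prepended to the reversed stream, so the new value at `p` is obtained from the
-- old one at `M.step p a`. The induction therefore runs over all `p` and `G`. The coin is shared by
-- all states, but only the marginal at each single state is needed.
theorem toOuterMeasure_dist_counter (w : List α) (p : τ) (G : Set V) :
    ((counter M f v₀ E r hr).dist w).toOuterMeasure {s | ∃ v ∈ G, s p = some v} =
      (firstHit M w.reverse p).elim 0 fun c => if f^[c] v₀ ∈ G then (r : ENNReal) ^ c else 0 := by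
  induction w using List.reverseRecOn generalizing p G with
  | nil =>
    change (PMF.pure _).toOuterMeasure _ = _
    rw [PMF.toOuterMeasure_pure_apply]
    by_cases hp : p ∈ M.accept <;> simp [firstHit, hp]
  | append_singleton w a ih =>
    have hstep : (counter M f v₀ E r hr).dist (w ++ [a]) = (coin r hr).bind fun b =>
        ((counter M f v₀ E r hr).dist w).map fun s p => if p ∈ M.accept then some v₀
          else if b then (s (M.step p a)).map f else none := by
      rw [ProbAutomaton.dist_snoc]
      exact PMF.bind_comm _ _ _
    rw [hstep, PMF.toOuterMeasure_bind_apply, tsum_fintype, Fintype.sum_bool,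
      PMF.toOuterMeasure_map_apply, PMF.toOuterMeasure_map_apply, List.reverse_append,
      List.reverse_singleton, List.singleton_append]
    by_cases hp : p ∈ M.accept
    · rw [firstHit_of_mem M hp]
      by_cases hG : v₀ ∈ G
      · have := (coin r hr).tsum_coe
        rw [tsum_fintype, Fintype.sum_bool] at this
        have huniv : ((counter M f v₀ E r hr).dist w).toOuterMeasure Set.univ = 1 :=
          (PMF.toOuterMeasure_apply_eq_one_iff _ _).2 (Set.subset_univ _)
        simpa [hp, hG, huniv, Set.preimage] using this
      · simp [hp, hG, Set.preimage]
    · have hset : ((fun (s : τ → Option V) p => if p ∈ M.accept then some v₀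
          else if true then (s (M.step p a)).map f else none) ⁻¹'
          {s | ∃ v ∈ G, s p = some v}) = {s | ∃ v ∈ f ⁻¹' G, s (M.step p a) = some v} := by
        ext s
        simp only [Set.mem_preimage, Set.mem_ofPred_eq, if_neg hp, if_true, Option.map_eq_some_iff]
        constructor
        · rintro ⟨_, hv, u, hu, rfl⟩; exact ⟨u, hv, hu⟩
        · rintro ⟨u, hv, hu⟩; exact ⟨_, hv, u, hu, rfl⟩
      have hset' : ((fun (s : τ → Option V) p => if p ∈ M.accept then some v₀
          else if false then (s (M.step p a)).map f else none) ⁻¹'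
          {s | ∃ v ∈ G, s p = some v}) = ∅ := by
        ext s
        simp [hp]
      rw [hset, hset', ih, firstHit, if_neg hp, MeasureTheory.measure_empty, mul_zero, add_zero,
        coin_apply, if_pos rfl]
      cases hc : firstHit M w.reverse (M.step p a) with
      | none => simp
      | some c =>
        simp only [Option.elim_some, Option.map_some, Function.iterate_succ_apply', Set.mem_preimage,
          Nat.succ_eq_add_one]
        split_ifs <;> simp [pow_succ']

open scoped Classical in
theorem acceptProb_counter (w : List α) :
    (counter M f v₀ E r hr).acceptProb w =
      (firstHit M w.reverse M.start).elim 0 fun c => if f^[c] v₀ ∈ E then (r : ℝ) ^ c else 0 := by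
  rw [ProbAutomaton.acceptProb,
    show (counter M f v₀ E r hr).accept = {s | ∃ v ∈ E, s M.start = some v} from rfl,
    toOuterMeasure_dist_counter]
  cases firstHit M w.reverse M.start with
  | none => simp
  | some c => simp only [Option.elim_some]; split_ifs <;> simp

end Counter

/-! ### Upper bounds on the space complexity -/

/-- For every positive error probability there are algorithms of size `O(f)` for the sliding
window problem of `L`. -/
def HasCost (pad : α) (f : ℕ → ℝ) (L : Language α) : Prop :=
  ∀ ε : ℝ, 0 < ε → ∃ C : ℝ, ∀ᶠ n in atTop, ∃ (σ : Type) (_ : Finite σ) (P : ProbAutomaton α σ),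
    P.IsFor (SW pad n L) ε ∧ Real.logb 2 (Nat.card σ) ≤ C * f n

theorem randSpace_le {pad : α} {L : Language α} {n : ℕ} {σ : Type} [Finite σ]
    {P : ProbAutomaton α σ} (h : P.IsFor (SW pad n L) (1 / 3)) :
    randSpace pad L n ≤ Real.logb 2 (Nat.card σ) := by
  refine csInf_le ⟨0, ?_⟩ ⟨σ, inferInstance, P, h, rfl⟩
  rintro _ ⟨σ, _, P, -, rfl⟩
  have : Nonempty σ := ⟨P.init.support_nonempty.some⟩
  exact Real.logb_nonneg one_lt_two (by exact_mod_cast Nat.card_pos (α := σ))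

theorem randSpace_nonneg [Finite α] (pad : α) (L : Language α) (n : ℕ) :
    0 ≤ randSpace pad L n := by
  refine le_randSpace fun σ _ P _ => ?_
  have : Nonempty σ := ⟨P.init.support_nonempty.some⟩
  exact Real.logb_nonneg one_lt_two (by exact_mod_cast Nat.card_pos (α := σ))

theorem HasCost.isBigO [Finite α] {pad : α} {f : ℕ → ℝ} {L : Language α} (h : HasCost pad f L) :
    randSpace pad L =O[atTop] f := by
  obtain ⟨C, hC⟩ := h (1 / 3) (by norm_num)
  refine IsBigO.of_bound |C| (hC.mono fun n => ?_)
  rintro ⟨σ, _, P, hP, hle⟩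
  rw [Real.norm_of_nonneg (randSpace_nonneg _ _ _), Real.norm_eq_abs, ← abs_mul]
  exact ((randSpace_le hP).trans hle).trans (le_abs_self _)

theorem HasCost.mono {pad : α} {f g : ℕ → ℝ} {L : Language α} (h : HasCost pad f L)
    (hfg : ∀ᶠ n in atTop, |f n| ≤ g n) : HasCost pad g L := by
  intro ε hε
  obtain ⟨C, hC⟩ := h ε hε
  refine ⟨|C|, ?_⟩
  filter_upwards [hC, hfg] with n ⟨σ, hσ, P, hP, hle⟩ hn
  refine ⟨σ, hσ, P, hP, hle.trans ((le_abs_self _).trans ?_)⟩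
  rw [abs_mul]
  gcongr

theorem HasCost.compl {pad : α} {f : ℕ → ℝ} {L : Language α} (h : HasCost pad f L) :
    HasCost pad f Lᶜ := by
  intro ε hε
  obtain ⟨C, hC⟩ := h ε hε
  refine ⟨C, hC.mono fun n => ?_⟩
  rintro ⟨σ, hσ, P, hP, hle⟩
  exact ⟨σ, hσ, P.compl, hP.compl, hle⟩

/-- Because `HasCost` covers every error, both factors can be taken with error `ε / 2`, and no
amplification is needed. -/
theorem HasCost.inf {pad : α} {f : ℕ → ℝ} {L L' : Language α} (h : HasCost pad f L)
    (h' : HasCost pad f L') : HasCost pad f (L ⊓ L') := by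
  intro ε hε
  obtain ⟨C, hC⟩ := h (ε / 2) (by positivity)
  obtain ⟨C', hC'⟩ := h' (ε / 2) (by positivity)
  refine ⟨C + C', ?_⟩
  filter_upwards [hC, hC'] with n ⟨σ, hσ, P, hP, hle⟩ ⟨σ', hσ', P', hP', hle'⟩
  refine ⟨σ × σ', inferInstance, P.prod P', ?_, ?_⟩
  · have := hP.inf (by positivity) (by positivity) hP'
    rwa [add_halves] at this
  · have : Nonempty σ := ⟨P.init.support_nonempty.some⟩
    have : Nonempty σ' := ⟨P'.init.support_nonempty.some⟩
    rw [Nat.card_prod, Nat.cast_mul, Real.logb_mul (by exact_mod_cast Nat.card_pos.ne')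
      (by exact_mod_cast Nat.card_pos.ne'), add_mul]
    exact add_le_add hle hle'

theorem hasCost_of_mem_Len (pad : α) (f : ℕ → ℝ) {L : Language α} (h : L ∈ Len α) :
    HasCost pad f L := by
  intro ε hε
  refine ⟨0, Eventually.of_forall fun n => ?_⟩
  have key : ∀ A : Set Unit, ∀ w : List α,
      (⟨PMF.pure (), fun _ _ => PMF.pure (), A⟩ : ProbAutomaton α Unit).dist w = PMF.pure () := by
    intro A w
    induction w using List.reverseRecOn with
    | nil => rfl
    | append_singleton w a ih => rw [ProbAutomaton.dist_snoc, ih, PMF.pure_bind]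
  rcases h.2 n with h | h
  · refine ⟨Unit, inferInstance, ⟨PMF.pure (), fun _ _ => PMF.pure (), Set.univ⟩, ⟨fun w _ => ?_,
      fun w hw => (hw (h _ (lastN_length _ _ _))).elim⟩, by simp⟩
    rw [ProbAutomaton.acceptProb, key, PMF.toOuterMeasure_pure_apply]
    simp [hε.le]
  · refine ⟨Unit, inferInstance, ⟨PMF.pure (), fun _ _ => PMF.pure (), ∅⟩,
      ⟨fun w hw => (h _ (lastN_length _ _ _) hw).elim, fun w _ => ?_⟩, by simp⟩
    rw [ProbAutomaton.rejectProb, key, PMF.toOuterMeasure_pure_apply]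
    simp [hε.le]

theorem hasCost_of_mem_boolComb {pad : α} {f : ℕ → ℝ} {C : Set (Language α)}
    (h : ∀ K ∈ C, HasCost pad f K) {L : Language α} (hL : L ∈ BoolComb C) : HasCost pad f L := by
  refine BooleanSubalgebra.closure_bot_sup_induction (p := fun K _ => HasCost pad f K) h ?_ ?_ ?_ hL
  · refine hasCost_of_mem_Len pad f ⟨isRegular_accepts (⟨fun _ _ => (), (), ∅⟩ : DFA α Unit), fun n => Or.inr fun w _ hw => hw⟩
  · intro K _ K' _ hK hK'
    simpa using (hK.compl.inf hK'.compl).compl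
  · intro K _ hK
    exact hK.compl

/-- Suffixes of the window in a language, in terms of the reversed stream. -/
theorem rtake_mem_top_mul_iff {τ : Type} {M : DFA α τ} {K : Language α}
    (hM : M.accepts = K.reverse) {n : ℕ} {y : List α} :
    y.rtake n ∈ (⊤ * K : Language α) ↔
      ∃ c ≤ n, firstHit M y.reverse M.start = some c := by
  have hK : ∀ u : List α, u ∈ K ↔ M.eval u.reverse ∈ M.accept := fun u => by
    rw [← Language.reverse_mem_reverse, ← hM]; rfl
  rw [List.rtake_eq_reverse_take_reverse, Language.mem_mul]
  constructor
  · rintro ⟨a, -, b, hb, hab⟩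
    have h1 : b.reverse <+: y.reverse.take n := ⟨a.reverse, by
      rw [← List.reverse_append, hab, List.reverse_reverse]⟩
    have h2 : b.reverse = y.reverse.take b.length := by
      have := List.prefix_iff_eq_take.1 (h1.trans (List.take_prefix _ _))
      simpa using this
    have h3 : b.length ≤ n := by
      have := h1.length_le
      simp at this
      omega
    rw [hK, h2] at hb
    obtain ⟨c, hc, hc'⟩ := exists_firstHit_le M hb
    exact ⟨c, hc.trans h3, hc'⟩
  · rintro ⟨c, hc, hfc⟩
    obtain ⟨-, h2⟩ := evalFrom_take_of_firstHit M hfc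
    obtain ⟨e, he⟩ := List.take_prefix_take_left (l := y.reverse) hc
    refine ⟨e.reverse, trivial, (y.reverse.take c).reverse, ?_, ?_⟩
    · rw [hK, List.reverse_reverse]; exact h2
    · rw [← List.reverse_append, he]

theorem rtake_mem_iff {τ : Type} {M : DFA α τ} {L : Language α} (hM : M.accepts = L.reverse)
    {n : ℕ} {y : List α} : y.rtake n ∈ L ↔ M.eval (y.reverse.take n) ∈ M.accept := by
  rw [← Language.reverse_mem_reverse, ← hM, List.rtake_eq_reverse_take_reverse,
    List.reverse_reverse]
  rfl

theorem hasCost_top_mul_singleton [Finite α] (pad : α) (w : List α) :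
    HasCost pad (fun _ => 1) (⊤ * {w} : Language α) := by
  have hreg : Language.IsRegular ({w} : Language α) := isRegular_of_take (w.length + 1) _ fun u => by
    change u = w ↔ u.take (w.length + 1) = w
    constructor
    · rintro rfl; simp
    · intro h
      have := congrArg List.length h
      rw [List.length_take] at this
      rwa [List.take_of_length_le (by omega)] at h
  obtain ⟨τ, _, M, hM⟩ := hreg.reverse
  intro ε hε
  refine ⟨Real.logb 2 (Nat.card (τ → Option Unit)), ?_⟩
  filter_upwards [eventually_ge_atTop w.length] with n hn
  -- A hit can only occur at distance `w.length`, which is at most `n`. So it suffices to record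
  -- whether there is a hit, and `Unit` serves as counter.
  have key : ∀ y : List α, y.rtake n ∈ (⊤ * {w} : Language α) ↔
      ∃ c, firstHit M y.reverse M.start = some c := by
    intro y
    rw [rtake_mem_top_mul_iff hM]
    refine ⟨fun ⟨c, _, h⟩ => ⟨c, h⟩, fun ⟨c, h⟩ => ⟨c, ?_, h⟩⟩
    obtain ⟨h1, h2⟩ := evalFrom_take_of_firstHit M h
    have h3 : y.reverse.take c ∈ M.accepts := h2
    rw [hM] at h3
    have h4 : (y.reverse.take c).reverse = w := h3
    have := congrArg List.length h4
    simp only [List.length_reverse, List.length_take] at this h1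
    omega
  obtain ⟨P, hP⟩ := exists_isFor_SW pad (n := n) (ε := ε) (L := ⊤ * {w})
    (counter M (V := Unit) id () Set.univ 1 le_rfl)
    (fun y _ hy => by
      obtain ⟨c, hc⟩ := (key y).1 hy
      rw [acceptProb_counter, hc]
      simp [hε.le])
    (fun y _ hy => by
      rw [acceptProb_counter]
      cases hc : firstHit M y.reverse M.start with
      | none => simpa using hε.le
      | some c => exact (hy ((key y).2 ⟨c, hc⟩)).elim)
  exact ⟨_, inferInstance, P, hP, by simp⟩

theorem hasCost_of_mem_ST [Finite α] (pad : α) {L : Language α} (h : L ∈ ST α) :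
    HasCost pad (fun _ => 1) L := by
  refine hasCost_of_mem_boolComb (C := {L : Language α | ∃ w : List α, L = ⊤ * {w}}) ?_ h
  rintro _ ⟨w, rfl⟩
  exact hasCost_top_mul_singleton pad w

theorem logb_card_counter {τ : Type} [Finite τ] {m : ℕ} {x : ℝ} (h : (m : ℝ) + 1 ≤ x) :
    Real.logb 2 (Nat.card (τ → Option (Fin m))) ≤ Nat.card τ * Real.logb 2 x := by
  rw [Nat.card_fun, Finite.card_option, Nat.card_fin, Nat.cast_pow, Real.logb_pow]
  gcongr
  · norm_num
  · push_cast; exact h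

theorem hasCost_of_mem_LI (pad : α) {L : Language α} (h : L ∈ LI α) :
    HasCost pad log2 L := by
  obtain ⟨K, hK, rfl⟩ := h
  obtain ⟨τ, _, M, hM⟩ := hK.reverse
  intro ε hε
  refine ⟨Nat.card τ * 2, ?_⟩
  filter_upwards [eventually_ge_atTop 3] with n hn
  -- The counter saturates at `n + 1`, which stands for every distance beyond the window.
  let f : Fin (n + 2) → Fin (n + 2) := fun v => ⟨min (v + 1) (n + 1), by omega⟩
  have hf : ∀ c, ((f^[c] 0 : Fin (n + 2)) : ℕ) = min c (n + 1) := by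
    intro c
    induction c with
    | zero => simp
    | succ c ih =>
      rw [Function.iterate_succ_apply']
      simp only [f, ih]
      omega
  have hfE : ∀ c, f^[c] 0 ∈ {v : Fin (n + 2) | (v : ℕ) ≤ n} ↔ c ≤ n := fun c => by
    change (_ : ℕ) ≤ n ↔ _
    rw [hf]; omega
  obtain ⟨P, hP⟩ := exists_isFor_SW pad (n := n) (ε := ε) (L := ⊤ * K)
    (counter M f 0 {v | (v : ℕ) ≤ n} 1 le_rfl)
    (fun y _ hy => by
      obtain ⟨c, hcn, hc⟩ := (rtake_mem_top_mul_iff hM).1 hy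
      rw [acceptProb_counter, hc, Option.elim_some, if_pos ((hfE c).2 hcn)]
      simp [hε.le])
    (fun y _ hy => by
      rw [acceptProb_counter]
      cases hc : firstHit M y.reverse M.start with
      | none => simpa using hε.le
      | some c =>
        rw [Option.elim_some, if_neg]
        · exact hε.le
        · rw [hfE]
          exact fun hcn => hy ((rtake_mem_top_mul_iff hM).2 ⟨c, hcn, hc⟩))
  refine ⟨_, inferInstance, P, hP, ?_⟩
  refine (logb_card_counter (x := (n : ℝ) ^ 2) ?_).trans ?_
  · have : (3 : ℝ) ≤ n := by exact_mod_cast hn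
    push_cast
    nlinarith
  · rw [Real.logb_pow, log2]
    push_cast
    rw [mul_assoc]

/-! ### Suffix-free languages -/

/-- A crude consequence of Chebyshev's bound. Polynomially many primes are enough, since a power of
`m` costs only a constant factor in `log m`. -/
theorem eventually_sqrt_le_primeCounting :
    ∀ᶠ m : ℕ in atTop, √(m : ℝ) ≤ Nat.primeCounting m := by
  have h1 : ∀ᶠ x : ℝ in atTop, ‖Real.log x‖ ≤ (1 / 8) * ‖x ^ (1 / 2 : ℝ)‖ :=
    (isLittleO_log_rpow_atTop (by norm_num)).bound (by norm_num)
  filter_upwards [tendsto_natCast_atTop_atTop.eventually h1, eventually_ge_atTop 4] with m hm hm4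
  have hm4' : (4 : ℝ) ≤ m := by exact_mod_cast hm4
  have hlog : 0 < Real.log m := Real.log_pos (by linarith)
  rw [← Real.sqrt_eq_rpow, Real.norm_of_nonneg hlog.le, Real.norm_of_nonneg (Real.sqrt_nonneg _)]
    at hm
  have hs : √(m : ℝ) * √(m : ℝ) = m := Real.mul_self_sqrt (by positivity)
  have hs2 : 2 ≤ √(m : ℝ) := Real.le_sqrt_of_sq_le (by linarith)
  have hpsi := (Chebyshev.psi_ge m).trans (Chebyshev.psi_le_primeCounting_mul_log m)
  have hlog1 : Real.log (m + 1) ≤ 2 * Real.log m := by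
    rw [show (2 : ℝ) * Real.log m = Real.log ((m : ℝ) ^ 2) by simp]
    exact Real.log_le_log (by positivity) (by nlinarith)
  have hlog2 := Real.log_two_gt_d9
  have : √(m : ℝ) * Real.log m ≤ Nat.primeCounting m * Real.log m := by nlinarith
  exact le_of_mul_le_mul_right this hlog

theorem two_pow_card_primeFactors_le {d : ℕ} (hd : d ≠ 0) : 2 ^ d.primeFactors.card ≤ d :=
  (Finset.pow_card_le_prod _ _ _ fun _ hp => (Nat.prime_of_mem_primeFactors hp).two_le).trans
    (Nat.le_of_dvd hd.bot_lt (Nat.prod_primeFactors_dvd d))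

/-- An elementary bound showing that a counter which loses its value with probability `q` per step
rarely keeps it for many more than `1 / q` steps. -/
theorem one_sub_pow_mul_le {q : ℝ} (h0 : 0 ≤ q) (h1 : q ≤ 1) (c : ℕ) :
    (1 - q) ^ c * (1 + c * q) ≤ 1 := by
  calc (1 - q) ^ c * (1 + c * q) ≤ (1 - q) ^ c * (1 + q) ^ c :=
        mul_le_mul_of_nonneg_left (one_add_mul_le_pow (by linarith) c)
          (pow_nonneg (by linarith) c)
    _ = (1 - q * q) ^ c := by rw [← mul_pow]; ring
    _ ≤ 1 := pow_le_one₀ (by nlinarith) (by nlinarith)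

/-- The number of primes in a finite set that divide a nonzero difference. -/
theorem card_filter_modEq_le (T : Finset ℕ) (hT : ∀ p ∈ T, p.Prime) {c n : ℕ} (hcn : c ≠ n) {B : ℝ}
    (hn : (n : ℝ) ≤ B) (hc : (c : ℝ) ≤ B) :
    ((T.filter fun p => c % p = n % p).card : ℝ) ≤ Real.logb 2 B := by
  have hd : Nat.dist c n ≠ 0 := fun h => hcn (Nat.eq_of_dist_eq_zero h)
  have hsub : (T.filter fun p => c % p = n % p) ⊆ (Nat.dist c n).primeFactors := by
    intro p hp
    rw [Finset.mem_filter] at hp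
    refine Nat.mem_primeFactors.2 ⟨hT p hp.1, ?_, hd⟩
    have h1 : c ≡ n [MOD p] := hp.2
    rcases le_total c n with h | h
    · rw [Nat.dist_eq_sub_of_le h]; exact (Nat.modEq_iff_dvd' h).1 h1
    · rw [Nat.dist_eq_sub_of_le_right h]; exact (Nat.modEq_iff_dvd' h).1 h1.symm
  have h2 : (2 : ℝ) ^ (T.filter fun p => c % p = n % p).card ≤ B := by
    have h3 : 2 ^ (T.filter fun p => c % p = n % p).card ≤ Nat.dist c n :=
      (Nat.pow_le_pow_right two_pos (Finset.card_le_card hsub)).trans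
        (two_pow_card_primeFactors_le hd)
    have h4 : Nat.dist c n ≤ max c n := by
      rcases le_total c n with h | h
      · rw [Nat.dist_eq_sub_of_le h]; omega
      · rw [Nat.dist_eq_sub_of_le_right h]; omega
    have h5 : ((max c n : ℕ) : ℝ) ≤ B := by
      rw [Nat.cast_max]; exact max_le hc hn
    exact le_trans (by exact_mod_cast h3.trans h4) h5
  have hB : 0 < B := lt_of_lt_of_le (by positivity) h2
  rw [Real.le_logb_iff_rpow_le one_lt_two hB, Real.rpow_natCast]
  exact h2

/-- The algorithm for suffix-free languages: count modulo a random prime below `m`, and forget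
the counter values with a small probability. -/
theorem exists_isFor_of_mem_SF (pad : α) {L : Language α} {τ : Type} [Finite τ] {M : DFA α τ}
    (hM : M.accepts = L.reverse) (hSF : ∀ x y : List α, x ++ y ∈ L → x ≠ [] → y ∉ L)
    {ε : ℝ} (hε : 0 < ε) (hε1 : ε ≤ 1) {n m : ℕ} (hn : 0 < n)
    (hm : Real.logb 2 (n / ε ^ 2) ≤ ε * Nat.primeCounting m) (hm2 : 2 ≤ m) :
    ∃ (σ : Type) (_ : Finite σ) (P : ProbAutomaton α σ), P.IsFor (SW pad n L) ε ∧
      Real.logb 2 (Nat.card σ) ≤ (Nat.card τ + 1) * Real.logb 2 (m + 2) := by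
  classical
  let T : Finset ℕ := (Finset.range (m + 1)).filter Nat.Prime
  have hT : ∀ p ∈ T, p.Prime := fun p hp => (Finset.mem_filter.1 hp).2
  have hTm : ∀ p ∈ T, p ≤ m := fun p hp =>
    Nat.lt_succ_iff.1 (Finset.mem_range.1 (Finset.mem_filter.1 hp).1)
  have hcardT : T.card = Nat.primeCounting m := (Nat.count_eq_card_filter_range _ _).symm
  have : Nonempty T := ⟨⟨2, Finset.mem_filter.2 ⟨Finset.mem_range.2 (by omega), Nat.prime_two⟩⟩⟩
  have hTpos : (0 : ℝ) < T.card := by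
    exact_mod_cast Finset.card_pos.2 (Finset.nonempty_coe_sort.1 this)
  have hn' : (0 : ℝ) < n := by exact_mod_cast hn
  have hn1 : (1 : ℝ) ≤ n := by exact_mod_cast hn
  set q := ε / n with hq
  have hq0 : 0 ≤ q := by positivity
  have hq1 : q ≤ 1 := (div_le_one hn').2 (hε1.trans hn1)
  let r : NNReal := ⟨1 - q, by linarith⟩
  have hr : r ≤ 1 := by
    rw [← NNReal.coe_le_coe]; change 1 - q ≤ 1; linarith
  have hrq : (r : ℝ) = 1 - q := rfl
  let f : ℕ → Fin (m + 1) → Fin (m + 1) := fun p v => Fin.ofNat (m + 1) ((v + 1) % p)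
  have hf : ∀ p ∈ T, ∀ c, (((f p)^[c] 0 : Fin (m + 1)) : ℕ) = c % p := by
    intro p hp c
    induction c with
    | zero => simp
    | succ c ih =>
      rw [Function.iterate_succ_apply']
      change (((f p)^[c] 0 : Fin (m + 1)) + 1 : ℕ) % p % (m + 1) = _
      rw [ih, Nat.mod_add_mod]
      exact Nat.mod_eq_of_lt (Nat.lt_succ_of_le
        ((Nat.mod_lt _ (hT p hp).pos).le.trans (hTm p hp)))
  let P : T → ProbAutomaton α (τ → Option (Fin (m + 1))) := fun p =>
    counter M (f p) 0 {v | (v : ℕ) = n % p} r hr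
  have hE : ∀ (p : T) c, (f p)^[c] 0 ∈ {v : Fin (m + 1) | (v : ℕ) = n % p} ↔ c % p = n % p := by
    intro p c
    change (_ : ℕ) = _ ↔ _
    rw [hf p p.2]
  have hP : ∀ (p : T) y, (P p).acceptProb y = (firstHit M y.reverse M.start).elim 0 fun c =>
      if c % p = n % p then (1 - q) ^ c else 0 := by
    intro p y
    rw [acceptProb_counter]
    simp only [hE, hrq]
  -- By suffix-freeness, a hit at distance `c < n` would be a proper suffix in `L` of a window in
  -- `L`. So membership means that the first hit is exactly at `n`.
  have hhit : ∀ y : List α, n ≤ y.length →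
      (y.rtake n ∈ L ↔ firstHit M y.reverse M.start = some n) := by
    intro y hy
    rw [rtake_mem_iff hM]
    constructor
    · intro h
      obtain ⟨c, hc, hfc⟩ := exists_firstHit_le M h
      obtain ⟨-, h2⟩ := evalFrom_take_of_firstHit M hfc
      rcases hc.eq_or_lt with rfl | hlt
      · exact hfc
      · exfalso
        obtain ⟨e, he⟩ := List.take_prefix_take_left (l := y.reverse) hc
        have h3 : y.reverse.take n ∈ L.reverse := hM ▸ h
        have h4 : y.reverse.take c ∈ L.reverse := hM ▸ h2
        rw [← he, Language.mem_reverse, List.reverse_append] at h3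
        refine hSF _ _ h3 ?_ h4
        intro he0
        have := congrArg List.length he
        rw [List.reverse_eq_nil_iff.1 he0] at this
        simp only [List.append_nil, List.length_take, List.length_reverse] at this
        omega
    · intro h
      exact (evalFrom_take_of_firstHit M h).2
  obtain ⟨P', hP'⟩ := exists_isFor_SW pad (n := n) (ε := ε) (L := L) (ProbAutomaton.mix P)
    (fun y hy hyL => by
      have h1 : ∀ p : T, (P p).acceptProb y = (1 - q) ^ n := fun p => by
        rw [hP, (hhit y hy).1 hyL]; simp
      rw [ProbAutomaton.acceptProb_mix]
      simp only [h1, Finset.sum_const, Finset.card_univ, nsmul_eq_mul, Fintype.card_coe]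
      rw [mul_div_cancel_left₀ _ hTpos.ne']
      -- Bernoulli: the value survives `n` steps with probability at least `1 - n * q = 1 - ε`.
      have := one_add_mul_le_pow (a := -q) (by linarith) n
      rw [← sub_eq_add_neg, mul_neg, ← sub_eq_add_neg, hq, mul_div_cancel₀ _ hn'.ne'] at this
      exact this)
    (fun y hy hyL => by
      rw [ProbAutomaton.acceptProb_mix, Fintype.card_coe, div_le_iff₀ hTpos]
      simp only [hP]
      cases hc : firstHit M y.reverse M.start with
      | none => simpa using by positivity
      | some c =>
        have hcn : c ≠ n := by rintro rfl; exact hyL ((hhit y hy).2 hc)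
        have hpow0 : 0 ≤ (1 - q) ^ c := pow_nonneg (by linarith) c
        have hpow1 : (1 - q) ^ c ≤ 1 := pow_le_one₀ (by linarith) (by linarith)
        have hsum : ∑ p : T, (if c % p = n % p then (1 - q) ^ c else 0) =
            (T.filter fun p => c % p = n % p).card * (1 - q) ^ c := by
          rw [Finset.sum_coe_sort T (fun p => if c % p = n % p then (1 - q) ^ c else 0),
            ← Finset.sum_filter, Finset.sum_const, nsmul_eq_mul]
        simp only [Option.elim_some]
        rw [hsum]
        -- For moderate `c` at most a fraction `ε` of the primes divide the difference of `c` and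
        -- `n`. For larger `c` that may fail, but there the value has been forgotten with
        -- probability at least `1 - ε`.
        rcases le_total (c : ℝ) (n / ε ^ 2) with hcB | hcB
        · have hnB : (n : ℝ) ≤ n / ε ^ 2 := by
            rw [le_div_iff₀ (by positivity)]
            exact mul_le_of_le_one_right hn'.le (pow_le_one₀ hε.le hε1)
          have h1 := (card_filter_modEq_le T hT hcn hnB hcB).trans hm
          rw [← hcardT] at h1
          exact (mul_le_of_le_one_right (Nat.cast_nonneg _) hpow1).trans h1
        · have h1 : ((T.filter fun p => c % p = n % p).card : ℝ) ≤ T.card := by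
            exact_mod_cast Finset.card_filter_le _ _
          have h2 : 1 / ε ≤ c * q := by
            calc 1 / ε = n / ε ^ 2 * q := by rw [hq]; field_simp
              _ ≤ c * q := by gcongr
          have h3 : (1 - q) ^ c ≤ ε := by
            have h4 := one_sub_pow_mul_le hq0 hq1 c
            have h5 : (1 - q) ^ c * (1 / ε) ≤ 1 :=
              (mul_le_mul_of_nonneg_left (by linarith) hpow0).trans h4
            rwa [mul_one_div, div_le_one hε] at h5
          rw [mul_comm ε]
          exact mul_le_mul h1 h3 hpow0 hTpos.le)
  refine ⟨_, inferInstance, P', hP', ?_⟩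
  have hTle : T.card ≤ m + 2 :=
    (Finset.card_filter_le _ _).trans (by simp)
  have hV := logb_card_counter (τ := τ) (m := m + 1) (x := m + 2) (by push_cast; linarith)
  rw [Nat.card_prod, Nat.cast_mul, Real.logb_mul _ (by exact_mod_cast Nat.card_pos.ne')]
  · rw [Nat.card_eq_fintype_card, Fintype.card_coe, add_mul, one_mul, add_comm]
    refine add_le_add hV (Real.logb_le_logb_of_le one_lt_two hTpos ?_)
    exact_mod_cast hTle
  · rw [Nat.card_eq_fintype_card, Fintype.card_coe]
    exact hTpos.ne'

theorem tendsto_log2 : Tendsto log2 atTop atTop :=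
  (Real.tendsto_logb_atTop one_lt_two).comp tendsto_natCast_atTop_atTop

theorem tendsto_loglog2 : Tendsto loglog2 atTop atTop :=
  (Real.tendsto_logb_atTop one_lt_two).comp tendsto_log2

theorem hasCost_of_mem_SF (pad : α) {L : Language α} (h : L ∈ SF α) : HasCost pad loglog2 L := by
  obtain ⟨hreg, hSF⟩ := h
  obtain ⟨τ, _, M, hM⟩ := hreg.reverse
  intro ε' hε'
  set ε := min ε' 1
  have hε : 0 < ε := lt_min hε' one_pos
  refine ⟨(Nat.card τ + 1) * 5, ?_⟩
  -- With primes up to `log2 n ^ 4` there are at least `log2 n ^ 2` of them, more than the order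
  -- `log2 n` of bad ones; the factor `5` comes from bounding `m + 2` by `log2 n ^ 5`.
  have hceil : Tendsto (fun n : ℕ => ⌈log2 n ^ 4⌉₊) atTop atTop :=
    tendsto_nat_ceil_atTop.comp ((tendsto_pow_atTop (by norm_num)).comp tendsto_log2)
  filter_upwards [hceil.eventually eventually_sqrt_le_primeCounting, eventually_gt_atTop 0,
    hceil.eventually (eventually_ge_atTop 2), tendsto_log2.eventually_ge_atTop 2,
    tendsto_log2.eventually_ge_atTop (2 / ε),
    tendsto_log2.eventually_ge_atTop (Real.logb 2 (1 / ε ^ 2))] with n hpi hn hm2 hl2 hlε hlC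
  have hn' : (0 : ℝ) < n := by exact_mod_cast hn
  set x := log2 n with hx
  have hx0 : 0 < x := by linarith
  have hle : x ^ 2 ≤ √(⌈x ^ 4⌉₊ : ℝ) := by
    apply Real.le_sqrt_of_sq_le
    rw [← pow_mul]
    exact Nat.le_ceil _
  obtain ⟨σ, hσ, P, hP, hcard⟩ := exists_isFor_of_mem_SF pad hM hSF hε (min_le_right _ _) hn
    (m := ⌈x ^ 4⌉₊) (by
      rw [div_eq_mul_one_div, Real.logb_mul hn'.ne' (by positivity)]
      change x + _ ≤ _
      have h1 : 2 ≤ ε * x := by rw [div_le_iff₀' hε] at hlε; exact hlε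
      have h2 : ε * x ^ 2 ≤ ε * Nat.primeCounting ⌈x ^ 4⌉₊ :=
        mul_le_mul_of_nonneg_left (hle.trans hpi) hε.le
      nlinarith) hm2
  refine ⟨σ, hσ, P, hP.mono (min_le_left _ _), hcard.trans ?_⟩
  rw [mul_assoc]
  refine mul_le_mul_of_nonneg_left ?_ (by positivity)
  have h5 : ((⌈x ^ 4⌉₊ : ℕ) : ℝ) + 2 ≤ x ^ 5 := by
    have h1 := (Nat.ceil_lt_add_one (show 0 ≤ x ^ 4 by positivity)).le
    have h2 : (2 : ℝ) ^ 4 ≤ x ^ 4 := pow_le_pow_left₀ (by norm_num) hl2 4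
    have h3 : 2 * x ^ 4 ≤ x ^ 5 := by
      rw [pow_succ' x 4]; exact mul_le_mul_of_nonneg_right hl2 (by positivity)
    linarith
  have h6 := Real.logb_le_logb_of_le one_lt_two (by positivity) h5
  rw [Real.logb_pow] at h6
  exact_mod_cast h6

/-- Storing the window takes linear space. -/
theorem randSpace_isBigO_linear [Finite α] (pad : α) (L : Language α) :
    randSpace pad L =O[atTop] (fun n => (n : ℝ)) := by
  classical
  have := Fintype.ofFinite α
  refine IsBigO.of_bound (Real.logb 2 (Nat.card α)) (Eventually.of_forall fun n => ?_)
  rw [Real.norm_of_nonneg (randSpace_nonneg _ _ _), Real.norm_natCast]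
  have hcard : Nat.card {l : List α // l.length = n} = Nat.card α ^ n := by
    change Nat.card (List.Vector α n) = _
    rw [Nat.card_eq_fintype_card, Nat.card_eq_fintype_card, card_vector]
  have : Finite {l : List α // l.length = n} := (List.finite_length_eq α n).to_subtype
  let e : {l : List α // l.length = n} ≃ Fin (Nat.card {l : List α // l.length = n}) := Finite.equivFin _
  let P : ProbAutomaton α (Fin (Nat.card {l : List α // l.length = n})) :=
    { init := PMF.pure (e ⟨lastN pad n [], lastN_length pad n _⟩)
      step := fun q a => PMF.pure (e ⟨lastN pad n ((e.symm q).1 ++ [a]), lastN_length pad n _⟩)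
      accept := {q | (e.symm q).1 ∈ L} }
  have hd : ∀ w, P.dist w = PMF.pure (e ⟨lastN pad n w, lastN_length pad n _⟩) := by
    intro w
    induction w using List.reverseRecOn with
    | nil => rfl
    | append_singleton w a ih =>
      rw [ProbAutomaton.dist_snoc, ih, PMF.pure_bind]
      simp only [P, Equiv.symm_apply_apply, ← lastN_snoc]
  have hmem : ∀ w, e ⟨lastN pad n w, lastN_length pad n _⟩ ∈ P.accept ↔ w ∈ SW pad n L := by
    intro w
    change (e.symm (e _)).1 ∈ L ↔ _
    rw [Equiv.symm_apply_apply]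
    rfl
  have hP : P.IsFor (SW pad n L) (1 / 3) := by
    rw [P.isFor_iff]
    refine ⟨fun w hw => ?_, fun w hw => ?_⟩
    · rw [ProbAutomaton.acceptProb, hd, PMF.toOuterMeasure_pure_apply, if_pos ((hmem w).2 hw)]
      norm_num
    · rw [ProbAutomaton.acceptProb, hd, PMF.toOuterMeasure_pure_apply,
        if_neg fun h => hw ((hmem w).1 h)]
      norm_num
  refine (randSpace_le hP).trans ?_
  rw [Nat.card_fin, hcard, Nat.cast_pow, Real.logb_pow, mul_comm]

theorem le_randSpace_of_nontrivialAt [Finite α] {pad : α} {L : Language α} {n : ℕ}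
    (h : NontrivialAt L n) : 1 / 15 ≤ randSpace pad L n := by
  obtain ⟨⟨u, hu, huL⟩, v, hv, hvL⟩ := h
  have key : ∀ w : List α, w.length = n → (w ∈ SW pad n L ↔ w ∈ L) := by
    rintro w rfl
    change lastN pad _ w ∈ L ↔ _
    rw [lastN_of_le le_rfl]
    simp [List.rtake]
  refine le_randSpace fun σ _ P hP => ?_
  -- Augmented indexing with a single bit, encoded by a word in `L` and one outside.
  have := le_log_card_of_augmentedIndex hP 1 true (fun a => if a = [true] then u else v)
    (fun _ => []) fun b c r hk => by
      obtain rfl : b = [] := List.length_eq_zero_iff.1 (by omega)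
      obtain rfl : r = [] := List.length_eq_zero_iff.1 (by omega)
      cases c <;> simp [key u hu, key v hv, huL, hvL]
  simpa using this

/-! ### Comparison of the growth rates. -/

theorem OmegaBar.not_isBigO {f g h : ℕ → ℝ} (hf : OmegaBar f g) (hh : h =o[atTop] g)
    (hg : Tendsto g atTop atTop) : ¬ f =O[atTop] h := by
  intro hfh
  obtain ⟨c, hc, hfreq⟩ := hf
  obtain ⟨n, h1, h2, h3⟩ := (hfreq.and_eventually
    (((hfh.trans_isLittleO hh).bound (half_pos hc)).and (hg.eventually_gt_atTop 0))).exists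
  rw [Real.norm_of_nonneg h3.le, Real.norm_eq_abs] at h2
  nlinarith [le_abs_self (f n), mul_pos hc h3]

theorem isLittleO_one_loglog2 : (fun _ => (1 : ℝ)) =o[atTop] loglog2 :=
  isLittleO_const_left.2 (Or.inr (tendsto_norm_atTop_atTop.comp tendsto_loglog2))

theorem logb_two_isLittleO_id : (fun x => Real.logb 2 x) =o[atTop] (id : ℝ → ℝ) := by
  simp only [← Real.log_div_log, div_eq_inv_mul]
  exact Real.isLittleO_log_id_atTop.const_mul_left _

theorem isLittleO_loglog2_log2 : loglog2 =o[atTop] log2 :=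
  logb_two_isLittleO_id.comp_tendsto tendsto_log2

theorem isLittleO_log2_natCast : log2 =o[atTop] (fun n : ℕ => (n : ℝ)) :=
  logb_two_isLittleO_id.comp_tendsto tendsto_natCast_atTop_atTop

/-! ### Upper and lower bounds for the three classes. -/

section Classification

theorem hasCost_log2 (pad : α) {L : Language α} (h : L ∈ BoolComb (LI α ∪ Len α)) : HasCost pad log2 L := by
  refine hasCost_of_mem_boolComb ?_ h
  rintro K (hK | hK)
  · exact hasCost_of_mem_LI pad hK
  · exact hasCost_of_mem_Len pad _ hK

variable [Finite α] (pad : α) {L : Language α}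

theorem hasCost_one (h : L ∈ BoolComb (ST α ∪ Len α)) : HasCost pad (fun _ => 1) L := by
  refine hasCost_of_mem_boolComb ?_ h
  rintro K (hK | hK)
  · exact hasCost_of_mem_ST pad hK
  · exact hasCost_of_mem_Len pad _ hK

theorem hasCost_loglog2 (h : L ∈ BoolComb (ST α ∪ SF α ∪ Len α)) : HasCost pad loglog2 L := by
  refine hasCost_of_mem_boolComb ?_ h
  rintro K ((hK | hK) | hK)
  · refine (hasCost_of_mem_ST pad hK).mono ?_
    simpa using tendsto_loglog2.eventually_ge_atTop 1
  · exact hasCost_of_mem_SF pad hK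
  · exact hasCost_of_mem_Len pad _ hK

theorem omegaBar_loglog2_of_notMem (hL : L.IsRegular) (h : L ∉ BoolComb (ST α ∪ Len α)) :
    OmegaBar (randSpace pad L) loglog2 := by
  obtain ⟨σ, _, M, hM⟩ := hL.reverse
  by_contra hne
  exact h (mem_boolComb_ST_Len M hM fun v t t' hv hl ht => by_contra fun ht' =>
    hne (omegaBar_loglog2 M pad hM hv hl ht ht'))

theorem omegaBar_log2_of_notMem (hL : L.IsRegular) (h : L ∉ BoolComb (ST α ∪ SF α ∪ Len α)) :
    OmegaBar (randSpace pad L) log2 := by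
  obtain ⟨σ, _, M, hM⟩ := hL.reverse
  by_contra hne
  exact h (mem_boolComb_ST_SF_Len M hM fun v t t' hv hl hr hr' ht => by_contra fun ht' =>
    hne (omegaBar_log2 M pad hM hv hl hr hr' ht ht'))

theorem omegaBar_linear_of_notMem (hL : L.IsRegular) (h : L ∉ BoolComb (LI α ∪ Len α)) :
    OmegaBar (randSpace pad L) (fun n => (n : ℝ)) := by
  obtain ⟨σ, _, M, hM⟩ := hL.reverse
  by_contra hne
  exact h (mem_boolComb_LI_Len M hM fun y u v u' v' hl hu hv hua => by_contra fun hva =>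
    hne (omegaBar_linear pad M hM hl hu hv hua hva))

end Classification

end SlidingWindow

open SlidingWindow Filter Asymptotics in
theorem mainTheorem2 {α : Type*} [Finite α] (pad : α) (L : Language α) (hL : L.IsRegular) :
    -- the four possible growth rates
    (ThetaOne L (randSpace pad L) ∨
      ThetaBar (randSpace pad L) loglog2 ∨
      ThetaBar (randSpace pad L) log2 ∨
      ThetaBar (randSpace pad L) (fun n => (n : ℝ))) ∧
    -- the characterizations of the upper bounds
    (randSpace pad L =O[atTop] (fun _ => (1 : ℝ)) ↔ L ∈ BoolComb (ST α ∪ Len α)) ∧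
    (randSpace pad L =O[atTop] loglog2 ↔ L ∈ BoolComb (ST α ∪ SF α ∪ Len α)) ∧
    (randSpace pad L =O[atTop] log2 ↔ L ∈ BoolComb (LI α ∪ Len α)) ∧
    -- the matching lower bounds
    (L ∉ BoolComb (ST α ∪ Len α) → OmegaBar (randSpace pad L) loglog2) ∧
    (L ∉ BoolComb (ST α ∪ SF α ∪ Len α) → OmegaBar (randSpace pad L) log2) ∧
    (L ∉ BoolComb (LI α ∪ Len α) → OmegaBar (randSpace pad L) (fun n => (n : ℝ))) := by
  refine ⟨?_, ⟨fun h => by_contra fun hn => ?_, fun h => (hasCost_one pad h).isBigO⟩,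
    ⟨fun h => by_contra fun hn => ?_, fun h => (hasCost_loglog2 pad h).isBigO⟩,
    ⟨fun h => by_contra fun hn => ?_, fun h => (hasCost_log2 pad h).isBigO⟩,
    omegaBar_loglog2_of_notMem pad hL, omegaBar_log2_of_notMem pad hL,
    omegaBar_linear_of_notMem pad hL⟩
  -- The classes are tested in order of growth: the first that contains `L` gives the upper bound
  -- and failure of the preceding one the lower bound. Inclusions between the classes are not
  -- needed.
  · by_cases h1 : L ∈ BoolComb (ST α ∪ Len α)
    · exact Or.inl ⟨(hasCost_one pad h1).isBigO, 1 / 15, by norm_num,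
        fun n hn => le_randSpace_of_nontrivialAt hn⟩
    by_cases h2 : L ∈ BoolComb (ST α ∪ SF α ∪ Len α)
    · exact Or.inr (Or.inl ⟨(hasCost_loglog2 pad h2).isBigO, omegaBar_loglog2_of_notMem pad hL h1⟩)
    by_cases h3 : L ∈ BoolComb (LI α ∪ Len α)
    · exact Or.inr (Or.inr (Or.inl
        ⟨(hasCost_log2 pad h3).isBigO, omegaBar_log2_of_notMem pad hL h2⟩))
    · exact Or.inr (Or.inr (Or.inr
        ⟨randSpace_isBigO_linear pad L, omegaBar_linear_of_notMem pad hL h3⟩))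
  · exact (omegaBar_loglog2_of_notMem pad hL hn).not_isBigO isLittleO_one_loglog2
      tendsto_loglog2 h
  · exact (omegaBar_log2_of_notMem pad hL hn).not_isBigO isLittleO_loglog2_log2 tendsto_log2 h
  · exact (omegaBar_linear_of_notMem pad hL hn).not_isBigO isLittleO_log2_natCast
      tendsto_natCast_atTop_atTop h
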